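/- Let $\nu>0$, let $\mathbb H$ be the algebra of quaternions, $\mathbb S=\{I\in\mathbb H: I^2=-1\}$, and for $I\in\mathbb S$ put $\mathbb C_I=\mathbb R+\mathbb R I$, with Lebesgue measure $d\lambda_I(q)=dx\,dy$ for $q=x+yI$. A real differentiable function $f:\mathbb H\to\mathbb H$ is called slice regular if for every $I\in\mathbb S$ its restriction $f_I=f|_{\mathbb C_I}$ has continuous partial derivatives in $x,y$ and satisfies $\tfrac12\left(\frac{\partial}{\partial x}+I\frac{\partial}{\partial y}\right)f_I(x+yI)=0$ for all $x,y\in\mathbb R$. For $I\in\mathbb S$ let $\mathcal F^{2,\nu}_{slice}(\mathbb H)$ be the right $\mathbb H$-vector space of all slice regular $f$ with $$\|f\|^2_{\mathcal F^{2,\nu}_{slice}(\mathbb H)}:=\int_{\mathbb C_I}|f_I(q)|^2e^{-\nu|q|^2}\,d\lambda_I(q)<\infty,$$ with inner product $\langle f,g\rangle=\int_{\mathbb C_I}\overline{g_I(q)}\,f_I(q)\,e^{-\nu|q|^2}d\lambda_I(q)$. Let $L^2(\mathbb R;\mathbb H)$ be the right $\mathbb H$-vector space of (classes of) square integrable functions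 $\mathbb R\to\mathbb H$ for Lebesgue measure, with inner product $\langle\varphi,\psi\rangle=\int_{\mathbb R}\overline{\psi(x)}\,\varphi(x)\,dx$. Set $$A(q;x)=\left(\frac{\nu}{\pi}\right)^{3/4}e^{-\frac{\nu}{2}(q^2+x^2)+\nu\sqrt2\,qx},\qquad \mathcal B_\nu(\psi)(q)=\int_{\mathbb R}A(q;x)\,\psi(x)\,dx\qquad(q\in\mathbb H,\ x\in\mathbb R).$$ **Theorem.** For every choice of $I\in\mathbb S$ the following holds. The integral $\mathcal B_\nu(\psi)(q)$ converges absolutely for all $\psi\in L^2(\mathbb R;\mathbb H)$ and $q\in\mathbb H$, and $\mathcal B_\nu$ is a right $\mathbb H$-linear surjective isometry from $L^2(\mathbb R;\mathbb H)$ onto $\mathcal F^{2,\nu}_{slice}(\mathbb H)$: it is a bijection of $L^2(\mathbb R;\mathbb H)$ onto $\mathcal F^{2,\nu}_{slice}(\mathbb H)$ that preserves norms and inner products. -/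

import Mathlib

open MeasureTheory
open scoped Quaternion

noncomputable section

namespace QuaternionicSegalBargmann

/-- The restriction `f_I` of `f` to the slice `ℂ_I = ℝ + ℝ I`, read in the real coordinates
`(x, y)` of `q = x + y I`. -/
def sliceFun (f : ℍ → ℍ) (I : ℍ) (p : ℝ × ℝ) : ℍ :=
  f ((p.1 : ℍ) + (p.2 : ℍ) * I)

/-- The slice Cauchy-Riemann operator
`∂̄_I f (x + I y) = 1/2 (∂/∂x + I ∂/∂y) f_I (x + y I)`. -/
def dbar (I : ℍ) (f : ℍ → ℍ) (x y : ℝ) : ℍ :=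
  (1 / 2 : ℝ) • (deriv (fun s : ℝ => sliceFun f I (s, y)) x
    + I * deriv (fun t : ℝ => sliceFun f I (x, t)) y)

/-- Slice (left) regular functions on the whole of `ℍ`: real differentiable functions whose
restriction to every slice `ℝ + ℝ I`, `I² = -1`, is of class `C¹` and is annihilated
by `∂̄_I`. -/
structure SliceRegular (f : ℍ → ℍ) : Prop where
  differentiable : Differentiable ℝ f
  contDiff_slice : ∀ I : ℍ, I ^ 2 = -1 → ContDiff ℝ 1 (sliceFun f I)
  dbar_eq_zero : ∀ I : ℍ, I ^ 2 = -1 → ∀ x y : ℝ, dbar I f x y = 0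

/-- The Gaussian weight `exp (-ν |q|²)` at `q = x + y I`. -/
def weight (ν : ℝ) (I : ℍ) (p : ℝ × ℝ) : ℝ :=
  Real.exp (-ν * ‖(p.1 : ℍ) + (p.2 : ℍ) * I‖ ^ 2)

theorem continuous_slicePoint (I : ℍ) :
    Continuous fun p : ℝ × ℝ => (p.1 : ℍ) + (p.2 : ℍ) * I :=
  (Quaternion.continuous_coe.comp continuous_fst).add
    ((Quaternion.continuous_coe.comp continuous_snd).mul continuous_const)

theorem continuous_weight (ν : ℝ) (I : ℍ) : Continuous (weight ν I) :=
  Real.continuous_exp.comp (continuous_const.mul ((continuous_slicePoint I).norm.pow 2))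

theorem SliceRegular.continuous_slice {f : ℍ → ℍ} (hf : SliceRegular f) (I : ℍ) :
    Continuous (sliceFun f I) :=
  hf.differentiable.continuous.comp (continuous_slicePoint I)

theorem SliceRegular.diff_left {f : ℍ → ℍ} (hf : SliceRegular f) {I : ℍ} (hI : I ^ 2 = -1)
    (x y : ℝ) : DifferentiableAt ℝ (fun s : ℝ => sliceFun f I (s, y)) x :=
  DifferentiableAt.comp (g := sliceFun f I) x
    (((hf.contDiff_slice I hI).differentiable one_ne_zero) (x, y))
    (differentiableAt_id.prodMk (differentiableAt_const y))

theorem SliceRegular.diff_right {f : ℍ → ℍ} (hf : SliceRegular f) {I : ℍ} (hI : I ^ 2 = -1)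
    (x y : ℝ) : DifferentiableAt ℝ (fun t : ℝ => sliceFun f I (x, t)) y :=
  DifferentiableAt.comp (g := sliceFun f I) y
    (((hf.contDiff_slice I hI).differentiable one_ne_zero) (x, y))
    ((differentiableAt_const x).prodMk differentiableAt_id)

theorem SliceRegular.zero : SliceRegular (0 : ℍ → ℍ) where
  differentiable := differentiable_const 0
  contDiff_slice _ _ := contDiff_const
  dbar_eq_zero I _ x y := by simp [dbar, sliceFun]

theorem SliceRegular.add {f g : ℍ → ℍ} (hf : SliceRegular f) (hg : SliceRegular g) :
    SliceRegular (f + g) where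
  differentiable := hf.differentiable.add hg.differentiable
  contDiff_slice I hI := (hf.contDiff_slice I hI).add (hg.contDiff_slice I hI)
  dbar_eq_zero I hI x y := by
    have h1 := deriv_fun_add (hf.diff_left hI x y) (hg.diff_left hI x y)
    have h2 := deriv_fun_add (hf.diff_right hI x y) (hg.diff_right hI x y)
    have h3 := hf.dbar_eq_zero I hI x y
    have h4 := hg.dbar_eq_zero I hI x y
    have h5 : dbar I (f + g) x y = dbar I f x y + dbar I g x y := by
      unfold dbar
      rw [← smul_add]
      congr 1
      calc _ = (deriv (fun s : ℝ => sliceFun f I (s, y)) x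
              + deriv (fun s : ℝ => sliceFun g I (s, y)) x)
            + I * (deriv (fun t : ℝ => sliceFun f I (x, t)) y
              + deriv (fun t : ℝ => sliceFun g I (x, t)) y) := by rw [← h1, ← h2]; rfl
        _ = _ := by rw [mul_add]; abel
    rw [h5, h3, h4, add_zero]

theorem SliceRegular.mul_const {f : ℍ → ℍ} (hf : SliceRegular f) (c : ℍ) :
    SliceRegular (fun q => f q * c) where
  differentiable := hf.differentiable.mul_const c
  contDiff_slice I hI := (hf.contDiff_slice I hI).mul contDiff_const
  dbar_eq_zero I hI x y := by
    have h1 := deriv_mul_const (hf.diff_left hI x y) c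
    have h2 := deriv_mul_const (hf.diff_right hI x y) c
    have h3 := hf.dbar_eq_zero I hI x y
    have h5 : dbar I (fun q => f q * c) x y = dbar I f x y * c := by
      unfold dbar
      rw [smul_mul_assoc, add_mul, mul_assoc, ← h1, ← h2]
      rfl
    rw [h5, h3, zero_mul]

/-- The slice hyperholomorphic Bargmann-Fock space, computed on the slice `ℂ_I`: the slice
regular functions `f` on `ℍ` with `∫_{ℂ_I} |f_I(q)|² exp (-ν |q|²) dλ_I(q) < ∞`, as a right
vector space over `ℍ` (that is, a left vector space over `ℍᵐᵒᵖ`). -/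
def fockSpace (ν : ℝ) (I : ℍ) : Submodule ℍᵐᵒᵖ (ℍ → ℍ) where
  carrier := {f | SliceRegular f ∧
    Integrable (fun p : ℝ × ℝ => ‖sliceFun f I p‖ ^ 2 * weight ν I p)}
  zero_mem' := ⟨SliceRegular.zero, by simp [sliceFun]⟩
  add_mem' := by
    rintro f g ⟨hf, hf'⟩ ⟨hg, hg'⟩
    refine ⟨hf.add hg, ((hf'.add hg').const_mul 2).mono'
      ((((hf.add hg).continuous_slice I).norm.pow 2).mul
        (continuous_weight ν I)).aestronglyMeasurable (Filter.Eventually.of_forall fun p => ?_)⟩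
    have hw : 0 ≤ weight ν I p := (Real.exp_pos _).le
    rw [Real.norm_of_nonneg (mul_nonneg (sq_nonneg _) hw)]
    have h1 : ‖sliceFun (f + g) I p‖ ≤ ‖sliceFun f I p‖ + ‖sliceFun g I p‖ := norm_add_le _ _
    have h2 : ‖sliceFun (f + g) I p‖ ^ 2
        ≤ 2 * (‖sliceFun f I p‖ ^ 2 + ‖sliceFun g I p‖ ^ 2) := by
      nlinarith [norm_nonneg (sliceFun (f + g) I p),
        sq_nonneg (‖sliceFun f I p‖ - ‖sliceFun g I p‖)]
    calc _ ≤ 2 * (‖sliceFun f I p‖ ^ 2 + ‖sliceFun g I p‖ ^ 2) * weight ν I p :=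
          mul_le_mul_of_nonneg_right h2 hw
      _ = _ := by simp only [Pi.add_apply]; ring
  smul_mem' := by
    rintro c f ⟨hf, hf'⟩
    refine ⟨hf.mul_const c.unop, (hf'.const_mul (‖c.unop‖ ^ 2)).congr
      (Filter.Eventually.of_forall fun p => ?_)⟩
    have h : sliceFun (c • f) I p = sliceFun f I p * c.unop := rfl
    simp only [h, norm_mul]
    ring

/-- The inner product `⟨f, g⟩ = ∫_{ℂ_I} conj (g_I(q)) f_I(q) exp (-ν |q|²) dλ_I(q)`. -/
def fockInner (ν : ℝ) (I : ℍ) (f g : ℍ → ℍ) : ℍ :=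
  ∫ p : ℝ × ℝ, weight ν I p • (star (sliceFun g I p) * sliceFun f I p)

/-- The norm `‖f‖ = (∫_{ℂ_I} |f_I(q)|² exp (-ν |q|²) dλ_I(q))^{1/2}`. -/
def fockNorm (ν : ℝ) (I : ℍ) (f : ℍ → ℍ) : ℝ :=
  Real.sqrt (∫ p : ℝ × ℝ, ‖sliceFun f I p‖ ^ 2 * weight ν I p)

/-- The kernel `A(q; x) = (ν/π)^{3/4} exp (-ν/2 (q² + x²) + ν √2 q x)`. -/
def kernel (ν : ℝ) (q : ℍ) (x : ℝ) : ℍ :=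
  ((ν / Real.pi) ^ (3 / 4 : ℝ) : ℝ) •
    NormedSpace.exp ((-ν / 2 : ℝ) • (q ^ 2 + (x : ℍ) ^ 2) + (ν * √2 : ℝ) • (q * (x : ℍ)))

/-- The quaternionic Segal-Bargmann transform `B_ν ψ (q) = ∫_ℝ A(q; x) ψ(x) dx`. -/
def transform (ν : ℝ) (ψ : ℝ → ℍ) (q : ℍ) : ℍ :=
  ∫ x : ℝ, kernel ν q x * ψ x

end QuaternionicSegalBargmann

end

open scoped FourierTransform ENNReal

namespace QuaternionicSegalBargmann

/-! Left multiplication by `ℂ_I ≅ ℂ` makes `ℍ` a complex Hilbert space, and since `x` is real the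
quaternionic kernel at a point of `ℂ_I` is the classical Segal-Bargmann kernel. On one slice the
theorem is therefore the classical one for Hilbert-space-valued functions
(`sliceRestrict_transform`).

Isometry: at `z = u + iv`, with `u` fixed, the weighted transform is, up to a constant and a
unimodular factor, the Fourier transform in `v` of `ψ` times a Gaussian centred at `√2 u`
(`gaussianWeighted_complexTransform`). Plancherel in `v` and Tonelli in `u` give equality of norms.

Surjectivity: an isometry has closed range. The difference between an entire function and its
projection onto the range is represented by an entire function orthogonal to the range. The range
contains every `exp (ν z w̄) c`, and pairing with these evaluates at `w`
(`integral_inner_gaussianWeighted_exp`), so the difference vanishes (`exists_complexTransform_eq`).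

Passing back to `ℍ` takes three more ingredients: real differentiability of the transform across
slices (`differentiable_integral_exp`), the identity principle extending equality from one slice to
all (`SliceRegular.eq_of_eq_on_slice`), and polarization with right quaternionic scalars for the
inner product (`re_star_mul_integral`). -/

theorem eLpNorm_two_sq {α E : Type*} [MeasurableSpace α] {μ : Measure α} [NormedAddCommGroup E]
    (f : α → E) : eLpNorm f 2 μ ^ 2 = ∫⁻ x, ‖f x‖ₑ ^ 2 ∂μ := by
  simpa using eLpNorm_nnreal_pow_eq_lintegral (f := f) (μ := μ) (p := 2) two_ne_zero

/-! ### Plancherel for Fourier integrals on `L¹ ∩ L²`. -/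

section Plancherel

open scoped SchwartzMap

variable {V E : Type*} [NormedAddCommGroup V] [InnerProductSpace ℝ V] [FiniteDimensional ℝ V]
  [MeasurableSpace V] [BorelSpace V]
  [NormedAddCommGroup E] [InnerProductSpace ℂ E] [CompleteSpace E]

/-- On `L¹ ∩ L²`, the `L²`-Fourier transform is given by the Fourier integral. -/
theorem fourier_toLp_ae_eq {f : V → E} (h1 : Integrable f) (h2 : MemLp f 2) :
    ((𝓕 (h2.toLp f) : Lp (α := V) E 2) : V → E) =ᵐ[volume] 𝓕 f := by
  have hcont : Continuous (𝓕 f) :=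
    VectorFourier.fourierIntegral_continuous Real.continuous_fourierChar
      (by exact continuous_inner) h1
  -- Pair with a smooth compactly supported test function: the `L²` transform passes to it by
  -- duality of tempered distributions, the Fourier integral by Fubini.
  refine ae_eq_of_integral_contDiff_smul_eq
    ((Lp.memLp _).locallyIntegrable (by norm_num)) hcont.locallyIntegrable
    fun g hg hgs => ?_
  have hgc : HasCompactSupport (fun x => (g x : ℂ)) := hgs.comp_left (g := Complex.ofReal) rfl
  set G : 𝓢(V, ℂ) := hgc.toSchwartzMap (Complex.ofRealCLM.contDiff.comp hg) with hG
  have hGx : ∀ x, G x = (g x : ℂ) := fun x => rfl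
  have key := congrArg (fun T => T G) (Lp.fourier_toTemperedDistribution_eq (h2.toLp f))
  simp only [TemperedDistribution.fourier_apply, Lp.toTemperedDistribution_apply] at key
  have e1 : ∀ (h : V → E), ∫ x, g x • h x = ∫ x, G x • h x := fun h => by
    simp [hGx]
  rw [e1, e1, ← key]
  have e2 : ∫ x, (𝓕 G) x • (h2.toLp f : V → E) x = ∫ x, (𝓕 G) x • f x := by
    refine integral_congr_ae ?_
    filter_upwards [h2.coeFn_toLp] with x hx
    rw [hx]
  rw [e2]
  simpa using! VectorFourier.integral_fourierIntegral_smul_eq_flip (L := innerₗ V)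
    Real.continuous_fourierChar continuous_inner G.integrable h1

/-- The Plancherel theorem for the Fourier integral of a function in `L¹ ∩ L²`. -/
theorem lintegral_enorm_fourier_sq {f : V → E} (h1 : Integrable f) (h2 : MemLp f 2) :
    ∫⁻ ξ, ‖𝓕 f ξ‖ₑ ^ 2 = ∫⁻ x, ‖f x‖ₑ ^ 2 := by
  have h := Lp.norm_fourier_eq (h2.toLp f)
  rw [Lp.norm_toLp, Lp.norm_def,
    ENNReal.toReal_eq_toReal_iff' (Lp.eLpNorm_ne_top _) h2.eLpNorm_ne_top,
    eLpNorm_congr_ae (fourier_toLp_ae_eq h1 h2)] at h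
  rw [← eLpNorm_two_sq, ← eLpNorm_two_sq, h]

end Plancherel

/-! ### Norm and Lipschitz bounds for the exponential in a Banach algebra. -/

section ExpLipschitz

open scoped Nat

/-- As `a` and `b` need not commute, the difference telescopes through `a (aⁿ - bⁿ) + (a - b) bⁿ`.
-/
theorem norm_pow_succ_sub_pow_succ_le {𝔸 : Type*} [NormedRing 𝔸] [NormOneClass 𝔸] {a b : 𝔸} {R : ℝ}
    (ha : ‖a‖ ≤ R) (hb : ‖b‖ ≤ R) (n : ℕ) :
    ‖a ^ (n + 1) - b ^ (n + 1)‖ ≤ (n + 1) * R ^ n * ‖a - b‖ := by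
  have hR : 0 ≤ R := (norm_nonneg a).trans ha
  induction n with
  | zero => simp
  | succ n ih =>
    have e : a ^ (n + 1 + 1) - b ^ (n + 1 + 1)
        = a * (a ^ (n + 1) - b ^ (n + 1)) + (a - b) * b ^ (n + 1) := by
      rw [pow_succ' a (n + 1), pow_succ' b (n + 1)]; noncomm_ring
    have hbn : ‖b ^ (n + 1)‖ ≤ R ^ (n + 1) :=
      (norm_pow_le b _).trans (pow_le_pow_left₀ (norm_nonneg b) hb _)
    calc ‖a ^ (n + 1 + 1) - b ^ (n + 1 + 1)‖
        ≤ ‖a‖ * ‖a ^ (n + 1) - b ^ (n + 1)‖ + ‖a - b‖ * ‖b ^ (n + 1)‖ := by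
          rw [e]; exact (norm_add_le _ _).trans (add_le_add (norm_mul_le _ _) (norm_mul_le _ _))
      _ ≤ R * ((n + 1) * R ^ n * ‖a - b‖) + ‖a - b‖ * R ^ (n + 1) := by gcongr
      _ = ((n + 1 : ℕ) + 1) * R ^ (n + 1) * ‖a - b‖ := by push_cast; ring

theorem norm_exp_le (𝕜 : Type*) {𝔸 : Type*} [RCLike 𝕜] [NormedRing 𝔸] [NormOneClass 𝔸]
    [NormedAlgebra 𝕜 𝔸] [CompleteSpace 𝔸] (a : 𝔸) :
    ‖NormedSpace.exp a‖ ≤ Real.exp ‖a‖ := by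
  have hE : HasSum (fun n : ℕ => ‖a‖ ^ n / n !) (Real.exp ‖a‖) := by
    rw [Real.exp_eq_exp_ℝ]
    exact NormedSpace.expSeries_div_hasSum_exp ‖a‖
  refine (NormedSpace.exp_series_hasSum_exp' (𝕂 := 𝕜) a).norm_le_of_bounded hE fun n => ?_
  rw [norm_smul, norm_inv, RCLike.norm_natCast, div_eq_inv_mul]
  gcongr
  exact norm_pow_le a n

/-- The zeroth terms cancel, and in degree `n + 1` the factor `n + 1` from the power bound turns `1
/ (n + 1)!` into `1 / n!`, leaving the series of `exp R`. -/
theorem norm_exp_sub_exp_le (𝕜 : Type*) {𝔸 : Type*} [RCLike 𝕜] [NormedRing 𝔸] [NormOneClass 𝔸]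
    [NormedAlgebra 𝕜 𝔸] [CompleteSpace 𝔸] {a b : 𝔸} {R : ℝ} (ha : ‖a‖ ≤ R) (hb : ‖b‖ ≤ R) :
    ‖NormedSpace.exp a - NormedSpace.exp b‖ ≤ Real.exp R * ‖a - b‖ := by
  have hR : 0 ≤ R := (norm_nonneg a).trans ha
  have h : HasSum (fun n : ℕ => (n ! : 𝕜)⁻¹ • (a ^ n - b ^ n))
      (NormedSpace.exp a - NormedSpace.exp b) := by
    simp only [smul_sub]
    exact (NormedSpace.exp_series_hasSum_exp' (𝕂 := 𝕜) a).sub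
      (NormedSpace.exp_series_hasSum_exp' (𝕂 := 𝕜) b)
  have h' := (hasSum_nat_add_iff' 1).mpr h
  simp only [Finset.range_one, Finset.sum_singleton, pow_zero, sub_self, smul_zero, sub_zero] at h'
  have hE : HasSum (fun n : ℕ => R ^ n / n ! * ‖a - b‖) (Real.exp R * ‖a - b‖) := by
    rw [Real.exp_eq_exp_ℝ]
    exact (NormedSpace.expSeries_div_hasSum_exp R).mul_right _
  refine h'.norm_le_of_bounded hE fun n => ?_
  have hn : (0 : ℝ) < n ! := by positivity
  rw [norm_smul, norm_inv, RCLike.norm_natCast, Nat.factorial_succ]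
  calc _ ≤ (((n + 1) * n ! : ℕ) : ℝ)⁻¹ * ((n + 1) * R ^ n * ‖a - b‖) := by
        gcongr; exact norm_pow_succ_sub_pow_succ_le ha hb n
    _ = _ := by push_cast; field_simp

end ExpLipschitz

/-! ### Integrals of Banach-algebra exponentials with a parameter. -/

section ParametricExp

variable {𝕜 𝔸 M : Type*} [RCLike 𝕜] [NormedRing 𝔸]
  [NormedAlgebra 𝕜 𝔸] [NormedAddCommGroup M] [NormedSpace 𝕜 M]

variable [CompleteSpace 𝔸]

theorem aestronglyMeasurable_exp_apply (L : 𝔸 →L[𝕜] M →L[𝕜] M) (a b : 𝕜) {g : ℝ → M}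
    (hgm : AEStronglyMeasurable g) (q : 𝔸) :
    AEStronglyMeasurable fun x : ℝ =>
      L (NormedSpace.exp (a • q ^ 2 + (b * (x : 𝕜)) • q)) (g x) := by
  have hexp : Continuous (NormedSpace.exp : 𝔸 → 𝔸) :=
    continuous_iff_continuousAt.mpr fun x => (NormedSpace.exp_analytic (𝕂 := 𝕜) x).continuousAt
  have hp : Continuous fun x : ℝ => a • q ^ 2 + (b * (x : 𝕜)) • q :=
    continuous_const.add ((continuous_const.mul RCLike.continuous_ofReal).smul continuous_const)
  exact L.aestronglyMeasurable_comp₂ (hexp.comp hp).aestronglyMeasurable hgm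

variable [NormOneClass 𝔸]

theorem norm_smul_sq_add_smul_le {𝕜 𝔸 : Type*} [RCLike 𝕜] [NormedRing 𝔸] [NormOneClass 𝔸]
    [NormedAlgebra 𝕜 𝔸] (a b : 𝕜) {q : 𝔸} {R : ℝ} (hq : ‖q‖ ≤ R) (x : ℝ) :
    ‖a • q ^ 2 + (b * (x : 𝕜)) • q‖ ≤ ‖a‖ * R ^ 2 + ‖b‖ * R * |x| := by
  calc ‖a • q ^ 2 + (b * (x : 𝕜)) • q‖ ≤ ‖a‖ * ‖q‖ ^ 2 + ‖b‖ * |x| * ‖q‖ := by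
        refine (norm_add_le _ _).trans (add_le_add ?_ ?_)
        · rw [norm_smul]; gcongr; exact norm_pow_le q 2
        · rw [norm_smul, norm_mul, RCLike.norm_ofReal]
    _ ≤ ‖a‖ * R ^ 2 + ‖b‖ * |x| * R := by gcongr
    _ = _ := by ring

theorem integrable_exp_apply (L : 𝔸 →L[𝕜] M →L[𝕜] M) (a b : 𝕜) {g : ℝ → M}
    (hgm : AEStronglyMeasurable g)
    (hg : ∀ t : ℝ, Integrable fun x => Real.exp (t * |x|) * ‖g x‖) (q : 𝔸) :
    Integrable fun x : ℝ => L (NormedSpace.exp (a • q ^ 2 + (b * (x : 𝕜)) • q)) (g x) := by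
  refine ((hg (‖b‖ * ‖q‖)).const_mul (‖L‖ * Real.exp (‖a‖ * ‖q‖ ^ 2))).mono'
    (aestronglyMeasurable_exp_apply L a b hgm q) (Filter.Eventually.of_forall fun x => ?_)
  have h1 := (norm_exp_le 𝕜 (a • q ^ 2 + (b * (x : 𝕜)) • q)).trans
    (Real.exp_le_exp.mpr (norm_smul_sq_add_smul_le a b le_rfl x))
  calc _ ≤ ‖L‖ * ‖NormedSpace.exp (a • q ^ 2 + (b * (x : 𝕜)) • q)‖ * ‖g x‖ := L.le_opNorm₂ _ _
    _ ≤ ‖L‖ * Real.exp (‖a‖ * ‖q‖ ^ 2 + ‖b‖ * ‖q‖ * |x|) * ‖g x‖ := by gcongr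
    _ = _ := by rw [Real.exp_add]; ring

variable [NormedSpace ℝ M]

/-- Integrals of `exp (a q² + b x q)` against a rapidly decaying `g` depend differentiably on the
element `q` of the (possibly noncommutative) Banach algebra. -/
theorem differentiable_integral_exp (L : 𝔸 →L[𝕜] M →L[𝕜] M) (a b : 𝕜) {g : ℝ → M}
    (hgm : AEStronglyMeasurable g)
    (hg : ∀ t : ℝ, Integrable fun x => Real.exp (t * |x|) * ‖g x‖) :
    Differentiable 𝕜 fun q : 𝔸 =>
      ∫ x : ℝ, L (NormedSpace.exp (a • q ^ 2 + (b * (x : 𝕜)) • q)) (g x) := by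
  intro q₀
  set R : ℝ := ‖q₀‖ + 1 with hRdef
  have hR : 0 ≤ R := by positivity
  set p : 𝔸 → ℝ → 𝔸 := fun q x => a • q ^ 2 + (b * (x : 𝕜)) • q with hp
  have hpc : ∀ q, Continuous (p q) := fun q =>
    continuous_const.add ((continuous_const.mul RCLike.continuous_ofReal).smul continuous_const)
  have hexp : ContDiff 𝕜 1 (NormedSpace.exp : 𝔸 → 𝔸) :=
    contDiff_iff_contDiffAt.mpr fun x => (NormedSpace.exp_analytic (𝕂 := 𝕜) x).contDiffAt
  set D : ℝ → 𝔸 →L[𝕜] 𝔸 := fun x =>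
    a • fderiv 𝕜 (fun q : 𝔸 => q ^ 2) q₀ + (b * (x : 𝕜)) • ContinuousLinearMap.id 𝕜 𝔸 with hD
  have hDc : Continuous D := by fun_prop
  have hpD : ∀ x, HasFDerivAt (fun q => p q x) (D x) q₀ := fun x =>
    (((differentiable_pow 2).differentiableAt.hasFDerivAt).const_smul a).add
      ((b * (x : 𝕜)) • ContinuousLinearMap.id 𝕜 𝔸).hasFDerivAt
  set Φ : ℝ → 𝔸 →L[𝕜] 𝔸 := fun x => (fderiv 𝕜 NormedSpace.exp (p q₀ x)).comp (D x) with hΦ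
  have hΦc : Continuous Φ :=
    ((hexp.continuous_fderiv one_ne_zero).comp (hpc q₀)).clm_comp hDc
  have hpb : ∀ q, ‖q‖ ≤ R → ∀ x, ‖p q x‖ ≤ ‖a‖ * R ^ 2 + ‖b‖ * R * |x| :=
    fun q hq x => norm_smul_sq_add_smul_le a b hq x
  have hmeas : ∀ q, AEStronglyMeasurable (fun x => L (NormedSpace.exp (p q x)) (g x)) :=
    aestronglyMeasurable_exp_apply L a b hgm
  have hq₀ : ‖q₀‖ ≤ R := by simp [hRdef]
  -- Without commutativity the derivative of `exp` has no simple closed form, so domination rests on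
  -- the Lipschitz bound at `q₀`; `Φ` only has to be measurable.
  refine (hasFDerivAt_integral_of_dominated_loc_of_lip' (𝕜 := 𝕜) (μ := volume)
    (F := fun q x => L (NormedSpace.exp (p q x)) (g x)) (F' := fun x => (L.flip (g x)).comp (Φ x))
    (bound := fun x => ‖L‖ * (2 * ‖a‖ * R + ‖b‖) * Real.exp (‖a‖ * R ^ 2) *
      (Real.exp ((‖b‖ * R + 1) * |x|) * ‖g x‖))
    (Metric.ball_mem_nhds q₀ one_pos) (fun q _ => hmeas q) (integrable_exp_apply L a b hgm hg q₀) ?_ ?_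
    ((hg _).const_mul _) ?_).2.differentiableAt
  · exact (ContinuousLinearMap.compL 𝕜 𝔸 𝔸 M).aestronglyMeasurable_comp₂
      (L.flip.continuous.comp_aestronglyMeasurable hgm) hΦc.aestronglyMeasurable
  · refine Filter.Eventually.of_forall fun x q hq => ?_
    have hqR : ‖q‖ ≤ R := by
      have := norm_sub_norm_le q q₀
      rw [Metric.mem_ball, dist_eq_norm] at hq
      rw [hRdef]; linarith
    have h1 := norm_exp_sub_exp_le 𝕜 (hpb q hqR x) (hpb q₀ hq₀ x)
    have h2 : ‖p q x - p q₀ x‖ ≤ (2 * ‖a‖ * R + ‖b‖ * |x|) * ‖q - q₀‖ := by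
      have e : p q x - p q₀ x = a • (q ^ 2 - q₀ ^ 2) + (b * (x : 𝕜)) • (q - q₀) := by
        simp only [hp, smul_sub]; abel
      have h3 := norm_pow_succ_sub_pow_succ_le hqR hq₀ 1
      norm_num at h3
      rw [e]
      calc _ ≤ ‖a‖ * ‖q ^ 2 - q₀ ^ 2‖ + ‖b‖ * |x| * ‖q - q₀‖ := by
            refine (norm_add_le _ _).trans (add_le_add (norm_smul_le _ _) ?_)
            rw [norm_smul, norm_mul, RCLike.norm_ofReal]
        _ ≤ ‖a‖ * (2 * R * ‖q - q₀‖) + ‖b‖ * |x| * ‖q - q₀‖ := by gcongr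
        _ = _ := by ring
    -- The factor linear in `|x|` is absorbed into `exp |x|`, whence the `+ 1` in the exponent of
    -- the bound.
    have h4 : 2 * ‖a‖ * R + ‖b‖ * |x| ≤ (2 * ‖a‖ * R + ‖b‖) * Real.exp |x| := by
      have h5 := Real.add_one_le_exp |x|
      have h6 : 1 ≤ Real.exp |x| := by linarith [abs_nonneg x]
      have h7 : |x| ≤ Real.exp |x| := by linarith
      calc _ ≤ 2 * ‖a‖ * R * Real.exp |x| + ‖b‖ * Real.exp |x| := by
            refine add_le_add (le_mul_of_one_le_right (by positivity) h6) ?_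
            gcongr
        _ = _ := by ring
    calc ‖L (NormedSpace.exp (p q x)) (g x) - L (NormedSpace.exp (p q₀ x)) (g x)‖
        = ‖L (NormedSpace.exp (p q x) - NormedSpace.exp (p q₀ x)) (g x)‖ := by
          rw [map_sub, sub_apply]
      _ ≤ ‖L‖ * ‖NormedSpace.exp (p q x) - NormedSpace.exp (p q₀ x)‖ * ‖g x‖ := L.le_opNorm₂ _ _
      _ ≤ ‖L‖ * (Real.exp (‖a‖ * R ^ 2 + ‖b‖ * R * |x|) *
            (((2 * ‖a‖ * R + ‖b‖) * Real.exp |x|) * ‖q - q₀‖)) * ‖g x‖ := by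
          gcongr
          refine h1.trans ?_
          gcongr
          exact h2.trans (by gcongr)
      _ = _ := by
          rw [Real.exp_add, add_mul (‖b‖ * R), Real.exp_add, one_mul]; ring
  · refine Filter.Eventually.of_forall fun x => ?_
    exact (L.flip (g x)).hasFDerivAt.comp q₀
      (((hexp.differentiable one_ne_zero) (p q₀ x)).hasFDerivAt.comp q₀ (hpD x))

end ParametricExp

/-! ### Integrability against Gaussians. -/

section GaussianDecay

theorem memLp_exp_quadratic {b : ℝ} (hb : 0 < b) (c : ℝ) :
    MemLp (fun x : ℝ => Real.exp (-b * x ^ 2 + c * x)) 2 := by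
  rw [memLp_two_iff_integrable_sq (by fun_prop)]
  have h := (integrable_cexp_quadratic (b := (2 * b : ℝ)) (by simpa using hb)
    ((2 * c : ℝ) : ℂ) 0).norm
  refine h.congr (Filter.Eventually.of_forall fun x => ?_)
  simp only [Complex.norm_exp]
  rw [← Real.exp_nat_mul]
  congr 1
  simp [pow_two]
  ring

theorem memLp_exp_abs_gaussian {b : ℝ} (hb : 0 < b) (t : ℝ) :
    MemLp (fun x : ℝ => Real.exp (t * |x|) * Real.exp (-b * x ^ 2)) 2 := by
  refine ((memLp_exp_quadratic hb t).add (memLp_exp_quadratic hb (-t))).mono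
    (by fun_prop) (Filter.Eventually.of_forall fun x => ?_)
  rw [Real.norm_of_nonneg (by positivity), Pi.add_apply, Real.norm_of_nonneg (by positivity),
    ← Real.exp_add]
  rcases abs_cases x with ⟨h, _⟩ | ⟨h, _⟩ <;> rw [h]
  · rw [add_comm (t * x)]; exact le_add_of_nonneg_right (Real.exp_pos _).le
  · rw [mul_neg, ← neg_mul, add_comm (-t * x)]
    exact le_add_of_nonneg_left (Real.exp_pos _).le

/-- Hölder for two `L²` factors: a mere `L²` function times a Gaussian has the decay that
differentiation under the integral requires. -/
theorem integrable_exp_abs_mul_norm_gaussian_smul {E : Type*} [NormedAddCommGroup E]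
    [NormedSpace ℝ E] {b : ℝ} (hb : 0 < b) {ψ : ℝ → E} (hψ : MemLp ψ 2) (t : ℝ) :
    Integrable fun x => Real.exp (t * |x|) * ‖Real.exp (-b * x ^ 2) • ψ x‖ := by
  refine ((memLp_exp_abs_gaussian hb t).integrable_mul hψ.norm).congr
    (Filter.Eventually.of_forall fun x => ?_)
  simp only [Pi.mul_apply, norm_smul, Real.norm_of_nonneg (Real.exp_pos _).le, mul_assoc]

end GaussianDecay

/-! ### The complex transform with Hilbert-space values. -/

section ComplexTransform

variable {E : Type*} [NormedAddCommGroup E] [InnerProductSpace ℂ E]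

/-- The Segal-Bargmann kernel on `ℂ × ℝ`. -/
noncomputable def complexKernel (ν : ℝ) (z : ℂ) (x : ℝ) : ℂ :=
  ((ν / Real.pi) ^ (3 / 4 : ℝ) : ℝ) *
    Complex.exp ((-ν / 2 : ℝ) * (z ^ 2 + (x : ℂ) ^ 2) + (ν * √2 : ℝ) * (z * x))

/-- The Segal-Bargmann transform of functions with values in a complex Hilbert space. -/
noncomputable def complexTransform (ν : ℝ) (ψ : ℝ → E) (z : ℂ) : E :=
  ∫ x : ℝ, complexKernel ν z x • ψ x

/-- A function on `ℂ` in real coordinates, multiplied by the square root of the Gaussian weight. -/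
noncomputable def gaussianWeighted (ν : ℝ) (F : ℂ → E) (p : ℝ × ℝ) : E :=
  Real.exp (-ν / 2 * (p.1 ^ 2 + p.2 ^ 2)) • F (p.1 + p.2 * Complex.I)

/-- Moving the factor `exp (-ν x² / 2)` onto `ψ` leaves an exponential of the form `exp (a z² + b x
z)`, to which the parametric results apply. -/
theorem complexKernel_smul_eq (ν : ℝ) (z : ℂ) (x : ℝ) (v : E) :
    complexKernel ν z x • v = ((ν / Real.pi) ^ (3 / 4 : ℝ) : ℝ) •
      ContinuousLinearMap.lsmul ℂ ℂ (NormedSpace.exp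
        (((-ν / 2 : ℝ) : ℂ) • z ^ 2 + (((ν * √2 : ℝ) : ℂ) * (x : ℂ)) • z))
        (Real.exp (-(ν / 2) * x ^ 2) • v) := by
  rw [complexKernel, ContinuousLinearMap.lsmul_apply, ← Complex.exp_eq_exp_ℂ,
    ← Complex.coe_smul, ← Complex.coe_smul, smul_smul, smul_smul, Complex.ofReal_exp,
    mul_assoc, ← Complex.exp_add]
  congr 3
  push_cast
  simp only [smul_eq_mul]
  ring

theorem integrable_complexKernel_smul {ν : ℝ} (hν : 0 < ν) {ψ : ℝ → E} (hψ : MemLp ψ 2) (z : ℂ) :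
    Integrable fun x => complexKernel ν z x • ψ x := by
  simp only [complexKernel_smul_eq]
  refine Integrable.smul _ (integrable_exp_apply _ _ _ ?_ ?_ z)
  · exact (by fun_prop : Continuous fun x : ℝ => Real.exp (-(ν / 2) * x ^ 2)
      ).aestronglyMeasurable.smul hψ.1
  · exact integrable_exp_abs_mul_norm_gaussian_smul (half_pos hν) hψ

theorem differentiable_complexTransform {ν : ℝ} (hν : 0 < ν) {ψ : ℝ → E} (hψ : MemLp ψ 2) :
    Differentiable ℂ (complexTransform ν ψ) := by
  have h := differentiable_integral_exp (𝕜 := ℂ) (ContinuousLinearMap.lsmul ℂ ℂ)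
    ((-ν / 2 : ℝ) : ℂ) ((ν * √2 : ℝ) : ℂ) (g := fun x => Real.exp (-(ν / 2) * x ^ 2) • ψ x)
    ((by fun_prop : Continuous fun x : ℝ => Real.exp (-(ν / 2) * x ^ 2)
      ).aestronglyMeasurable.smul hψ.1)
    (integrable_exp_abs_mul_norm_gaussian_smul (half_pos hν) hψ)
  have e : complexTransform ν ψ = fun z => ((ν / Real.pi) ^ (3 / 4 : ℝ) : ℝ) • ∫ x : ℝ,
      ContinuousLinearMap.lsmul ℂ ℂ (NormedSpace.exp
        (((-ν / 2 : ℝ) : ℂ) • z ^ 2 + (((ν * √2 : ℝ) : ℂ) * (x : ℂ)) • z))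
        (Real.exp (-(ν / 2) * x ^ 2) • ψ x) := by
    funext z
    simp only [complexTransform, complexKernel_smul_eq]
    rw [integral_smul]
  rw [e]
  exact h.const_smul _

end ComplexTransform

/-! ### Norm preservation by Plancherel and Tonelli. -/

section Isometry

variable {E : Type*} [NormedAddCommGroup E] [InnerProductSpace ℂ E]

/-- Complete the square: the `v²` terms of weight and kernel cancel, the real part becomes `-ν/2 (x
- √2 u)²`, and the phase `i ν √2 v x` is the Fourier character at frequency `-ν v / (√2 π)`. -/
theorem gaussianWeighted_complexTransform (ν : ℝ) (ψ : ℝ → E) (u v : ℝ) :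
    gaussianWeighted ν (complexTransform ν ψ) (u, v) =
      (((ν / Real.pi) ^ (3 / 4 : ℝ) : ℝ) * Complex.exp (-(ν * u * v : ℝ) * Complex.I)) •
        𝓕 (fun x : ℝ => Real.exp (-(ν / 2) * (x - √2 * u) ^ 2) • ψ x)
          (-(ν / (√2 * Real.pi)) * v) := by
  have h2 : (√2 : ℂ) ^ 2 = 2 := by
    rw [← Complex.ofReal_pow, Real.sq_sqrt (by norm_num)]; norm_num
  have h2' : (√2 : ℂ) ≠ 0 := fun h => by simp [h] at h2
  have hpi : (Real.pi : ℂ) ≠ 0 := by simp [Real.pi_ne_zero]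
  rw [gaussianWeighted, complexTransform, Real.fourier_real_eq_integral_exp_smul, ← integral_smul,
    ← integral_smul]
  refine integral_congr_ae (Filter.Eventually.of_forall fun x => ?_)
  simp only [complexKernel]
  rw [← Complex.coe_smul, ← Complex.coe_smul, smul_smul, smul_smul, smul_smul]
  congr 1
  rw [Complex.ofReal_exp, Complex.ofReal_exp, mul_left_comm, ← Complex.exp_add, mul_assoc,
    mul_assoc, ← Complex.exp_add, ← Complex.exp_add]
  congr 2
  push_cast
  field_simp
  ring_nf
  simp only [Complex.I_sq, h2]
  linear_combination (ν * √2 * u ^ 2 : ℂ) * h2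

theorem lintegral_comp_mul_left_real {c : ℝ} (hc : c ≠ 0) (f : ℝ → ℝ≥0∞) :
    ∫⁻ x, f (c * x) = ENNReal.ofReal |c⁻¹| * ∫⁻ x, f x := by
  have h := (Homeomorph.mulLeft₀ c hc).measurableEmbedding.lintegral_map (μ := volume) f
  simp only [Homeomorph.coe_mulLeft₀] at h
  rw [← h, Real.map_volume_mul_left hc, lintegral_smul_measure, smul_eq_mul]

/-- The value does not depend on `x`; this is why integrating over `u` after Tonelli returns a
multiple of the norm of `ψ`. -/
theorem lintegral_gaussian_shift {ν : ℝ} (hν : 0 < ν) (x : ℝ) :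
    ∫⁻ u : ℝ, ENNReal.ofReal (Real.exp (-(ν / 2) * (x - √2 * u) ^ 2) ^ 2)
      = ENNReal.ofReal √(Real.pi / (2 * ν)) := by
  have h2 : √2 ^ 2 = (2 : ℝ) := Real.sq_sqrt (by norm_num)
  have h2' : √2 ≠ (0 : ℝ) := by positivity
  have e : ∀ u : ℝ, Real.exp (-(ν / 2) * (x - √2 * u) ^ 2) ^ 2
      = (fun u : ℝ => Real.exp (-(2 * ν) * u ^ 2)) (u - x / √2) := fun u => by
    rw [← Real.exp_nat_mul]
    congr 1
    field_simp
    ring_nf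
    linear_combination (4 * x * √2 * u - 2 * u ^ 2 * √2 ^ 2 - 2 * x ^ 2) * h2
  rw [lintegral_congr fun u => by rw [e u], ← ofReal_integral_eq_lintegral_ofReal,
    integral_sub_right_eq_self (fun u : ℝ => Real.exp (-(2 * ν) * u ^ 2)), integral_gaussian]
  · exact (integrable_exp_neg_mul_sq (by positivity)).comp_sub_right _
  · exact Filter.Eventually.of_forall fun u => (Real.exp_pos _).le

theorem continuous_gaussianWeighted (ν : ℝ) {F : ℂ → E} (hF : Continuous F) :
    Continuous (gaussianWeighted ν F) := by
  unfold gaussianWeighted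
  fun_prop

variable [CompleteSpace E]

theorem lintegral_gaussianWeighted_slice {ν : ℝ} (hν : 0 < ν) {ψ : ℝ → E} (hψ : MemLp ψ 2)
    (u : ℝ) :
    ∫⁻ v : ℝ, ‖gaussianWeighted ν (complexTransform ν ψ) (u, v)‖ₑ ^ 2
      = ENNReal.ofReal ((ν / Real.pi) ^ (3 / 2 : ℝ) * (√2 * Real.pi / ν)) *
        ∫⁻ x : ℝ, ENNReal.ofReal (Real.exp (-(ν / 2) * (x - √2 * u) ^ 2) ^ 2) * ‖ψ x‖ₑ ^ 2 := by
  set κ : ℝ := ν / (√2 * Real.pi) with hκ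
  have hκ0 : 0 < κ := by positivity
  set g : ℝ → E := fun x => Real.exp (-(ν / 2) * (x - √2 * u) ^ 2) • ψ x with hg
  have hw : MemLp (fun x : ℝ => Real.exp (-(ν / 2) * (x - √2 * u) ^ 2)) 2 := by
    refine ((memLp_exp_quadratic (half_pos hν) (ν * √2 * u)).const_mul
      (Real.exp (-(ν / 2) * (√2 * u) ^ 2))).congr_norm (by fun_prop)
      (Filter.Eventually.of_forall fun x => ?_)
    rw [← Real.exp_add]
    congr 2
    ring
  have hg1 : Integrable g := by
    have h : MemLp ((fun x : ℝ => Real.exp (-(ν / 2) * (x - √2 * u) ^ 2)) • ψ) 1 := hψ.smul hw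
    exact memLp_one_iff_integrable.mp h
  have hg2 : MemLp g 2 := by
    refine hψ.mono (hw.1.smul hψ.1) (Filter.Eventually.of_forall fun x => ?_)
    rw [hg]
    simp only [norm_smul]
    refine mul_le_of_le_one_left (norm_nonneg _) ?_
    rw [Real.norm_of_nonneg (Real.exp_pos _).le, Real.exp_le_one_iff]
    have := mul_nonneg (half_pos hν).le (sq_nonneg (x - √2 * u))
    linarith
  have hc : ∀ v : ℝ, ‖(((ν / Real.pi) ^ (3 / 4 : ℝ) : ℝ) *
      Complex.exp (-(ν * u * v : ℝ) * Complex.I))‖ₑ ^ 2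
      = ENNReal.ofReal ((ν / Real.pi) ^ (3 / 2 : ℝ)) := fun v => by
    have h0 : 0 < ν / Real.pi := by positivity
    rw [← ofReal_norm, ← ENNReal.ofReal_pow (norm_nonneg _), norm_mul,
      ← Complex.ofReal_neg, Complex.norm_exp_ofReal_mul_I, mul_one, Complex.norm_real,
      Real.norm_of_nonneg (by positivity), ← Real.rpow_natCast, ← Real.rpow_mul h0.le]
    norm_num
  calc _ = ∫⁻ v : ℝ, ENNReal.ofReal ((ν / Real.pi) ^ (3 / 2 : ℝ)) * ‖𝓕 g (-κ * v)‖ₑ ^ 2 := by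
        refine lintegral_congr fun v => ?_
        rw [gaussianWeighted_complexTransform ν, enorm_smul, mul_pow, hc]
    _ = ENNReal.ofReal ((ν / Real.pi) ^ (3 / 2 : ℝ)) * (ENNReal.ofReal |(-κ)⁻¹| *
          ∫⁻ x, ‖g x‖ₑ ^ 2) := by
        rw [lintegral_const_mul' _ _ ENNReal.ofReal_ne_top,
          lintegral_comp_mul_left_real (neg_ne_zero.mpr hκ0.ne') (fun ξ => ‖𝓕 g ξ‖ₑ ^ 2),
          lintegral_enorm_fourier_sq hg1 hg2]
    _ = _ := by
        rw [← mul_assoc, ← ENNReal.ofReal_mul (by positivity), inv_neg, abs_neg,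
          abs_of_pos (inv_pos.mpr hκ0), hκ, inv_div]
        congr 1
        refine lintegral_congr fun x => ?_
        rw [hg, enorm_smul, mul_pow, Real.enorm_of_nonneg (Real.exp_pos _).le,
          ← ENNReal.ofReal_pow (Real.exp_pos _).le]

/-- The Segal-Bargmann transform is isometric. -/
theorem lintegral_gaussianWeighted_complexTransform {ν : ℝ} (hν : 0 < ν) {ψ : ℝ → E}
    (hψ : MemLp ψ 2) :
    ∫⁻ p : ℝ × ℝ, ‖gaussianWeighted ν (complexTransform ν ψ) p‖ₑ ^ 2 = ∫⁻ x, ‖ψ x‖ₑ ^ 2 := by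
  have hcont := continuous_gaussianWeighted ν (differentiable_complexTransform hν hψ).continuous
  have hψm : AEMeasurable (fun x => ‖ψ x‖ₑ ^ 2) := hψ.1.enorm.pow_const 2
  have hwm : Measurable fun p : ℝ × ℝ =>
      ENNReal.ofReal (Real.exp (-(ν / 2) * (p.2 - √2 * p.1) ^ 2) ^ 2) := by fun_prop
  rw [Measure.volume_eq_prod, lintegral_prod _ (hcont.enorm.measurable.pow_const 2).aemeasurable]
  simp only [lintegral_gaussianWeighted_slice hν hψ]
  rw [lintegral_const_mul' _ _ ENNReal.ofReal_ne_top,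
    lintegral_lintegral_swap (hwm.aemeasurable.mul hψm.comp_snd)]
  have e : ∀ x : ℝ, ∫⁻ u : ℝ, ENNReal.ofReal (Real.exp (-(ν / 2) * (x - √2 * u) ^ 2) ^ 2) *
      ‖ψ x‖ₑ ^ 2 = ENNReal.ofReal √(Real.pi / (2 * ν)) * ‖ψ x‖ₑ ^ 2 := fun x => by
    rw [lintegral_mul_const' _ _ (by finiteness), lintegral_gaussian_shift hν]
  simp only [e]
  rw [lintegral_const_mul' _ _ ENNReal.ofReal_ne_top, ← mul_assoc,
    ← ENNReal.ofReal_mul (by positivity)]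
  -- Squared kernel constant, Jacobian of the frequency rescaling, and Gaussian integral: the
  -- exponent `3/4` in the kernel is the one making this product `1`.
  have hone : (ν / Real.pi) ^ (3 / 2 : ℝ) * (√2 * Real.pi / ν) * √(Real.pi / (2 * ν)) = 1 := by
    have h0 : 0 < ν / Real.pi := by positivity
    have e1 : (ν / Real.pi) ^ (3 / 2 : ℝ) = ν / Real.pi * √(ν / Real.pi) := by
      rw [Real.sqrt_eq_rpow, ← Real.rpow_one_add' h0.le (by norm_num)]
      norm_num
    have e2 : √(ν / Real.pi) * (√2 * √(Real.pi / (2 * ν))) = 1 := by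
      rw [← Real.sqrt_mul (by norm_num), ← Real.sqrt_mul h0.le]
      have : ν / Real.pi * (2 * (Real.pi / (2 * ν))) = 1 := by
        field_simp
      rw [this, Real.sqrt_one]
    have hpi := Real.pi_pos
    calc _ = (ν / Real.pi * (Real.pi / ν)) *
          (√(ν / Real.pi) * (√2 * √(Real.pi / (2 * ν)))) := by rw [e1]; ring
      _ = 1 := by rw [e2]; field_simp
  rw [hone, ENNReal.ofReal_one, one_mul]

end Isometry

/-! ### Gaussian mean value property. -/

section Reproducing

theorem integral_gaussian_smul_rotate {E : Type*} [NormedAddCommGroup E] [NormedSpace ℝ E] (ν : ℝ)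
    (H : ℂ → E) (c : Circle) :
    ∫ z : ℂ, Real.exp (-ν * ‖z‖ ^ 2) • H (c * z) = ∫ z : ℂ, Real.exp (-ν * ‖z‖ ^ 2) • H z := by
  have h := ((rotation c).measurePreserving).integral_comp
    (rotation c).toHomeomorph.measurableEmbedding (fun z : ℂ => Real.exp (-ν * ‖z‖ ^ 2) • H z)
  simpa [rotation_apply, Circle.norm_coe c] using h

variable {E : Type*} [NormedAddCommGroup E] [NormedSpace ℂ E] [CompleteSpace E]

/-- The mean value property of entire functions with respect to a Gaussian measure. -/
theorem integral_gaussian_smul_entire {ν : ℝ} (hν : 0 < ν) {H : ℂ → E} (hH : Differentiable ℂ H)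
    (hi : Integrable fun z : ℂ => Real.exp (-ν * ‖z‖ ^ 2) • H z) :
    ∫ z : ℂ, Real.exp (-ν * ‖z‖ ^ 2) • H z = (Real.pi / ν) • H 0 := by
  have hpi := Real.pi_pos
  -- The mean value property is applied to `w ↦ H (w z)` on the unit circle, which treats all `z`,
  -- including `0`, uniformly.
  have hmean : ∀ z : ℂ, ∫ θ in Set.Ioc 0 (2 * Real.pi), H (Circle.exp θ * z)
      = (2 * Real.pi) • H 0 := fun z => by
    have hd : Differentiable ℂ fun w : ℂ => H (w * z) :=
      hH.comp (differentiable_id.mul_const z)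
    have h := (hd.diffContOnCl (s := Metric.ball 0 |1|)).circleAverage
    rw [Real.circleAverage, zero_mul, inv_smul_eq_iff₀ (by positivity),
      intervalIntegral.integral_of_le (by positivity)] at h
    simpa [circleMap] using h
  have hrot : ∀ θ : ℝ, ∫ z : ℂ, Real.exp (-ν * ‖z‖ ^ 2) • H (Circle.exp θ * z)
      = ∫ z : ℂ, Real.exp (-ν * ‖z‖ ^ 2) • H z :=
    fun θ => integral_gaussian_smul_rotate ν H (Circle.exp θ)
  have hrotn : ∀ θ : ℝ, ∫ z : ℂ, ‖Real.exp (-ν * ‖z‖ ^ 2) • H (Circle.exp θ * z)‖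
      = ∫ z : ℂ, ‖Real.exp (-ν * ‖z‖ ^ 2) • H z‖ := fun θ => by
    simpa [norm_smul] using integral_gaussian_smul_rotate ν (fun z => ‖H z‖) (Circle.exp θ)
  have hroti : ∀ θ : ℝ, Integrable fun z : ℂ =>
      Real.exp (-ν * ‖z‖ ^ 2) • H (Circle.exp θ * z) := fun θ => by
    have h := ((rotation (Circle.exp θ)).measurePreserving).integrable_comp_of_integrable hi
    simpa [Function.comp_def, rotation_apply] using h
  have hprod : Integrable (Function.uncurry fun (θ : ℝ) (z : ℂ) =>
      Real.exp (-ν * ‖z‖ ^ 2) • H (Circle.exp θ * z))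
      ((volume.restrict (Set.Ioc 0 (2 * Real.pi))).prod volume) := by
    have hc : Continuous (Function.uncurry fun (θ : ℝ) (z : ℂ) =>
        Real.exp (-ν * ‖z‖ ^ 2) • H (Circle.exp θ * z)) := by
      have := hH.continuous
      unfold Function.uncurry
      fun_prop
    rw [integrable_prod_iff hc.aestronglyMeasurable]
    refine ⟨Filter.Eventually.of_forall hroti, ?_⟩
    simp only [Function.uncurry_apply_pair, hrotn]
    exact integrable_const _
  -- Average over rotations: in one order the Gaussian's invariance makes the `z`-integral constant
  -- in `θ`, in the other the circle mean gives `H 0`.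
  have hswap := integral_integral_swap hprod
  simp only [hrot, integral_smul, hmean] at hswap
  have hvol : (volume.restrict (Set.Ioc 0 (2 * Real.pi))).real Set.univ = 2 * Real.pi := by
    simp [hpi.le]
  rw [integral_const, integral_smul_const, GaussianFourier.integral_rexp_neg_mul_sq_norm hν, hvol,
    smul_comm, Complex.finrank_real_complex, Nat.cast_ofNat, div_self two_ne_zero,
    Real.rpow_one] at hswap
  exact smul_right_injective E (by positivity : 2 * Real.pi ≠ 0) hswap

end Reproducing

/-! ### The reproducing formula. -/

section ReproducingKernel

variable {E : Type*} [NormedAddCommGroup E] [InnerProductSpace ℂ E]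

/-- Translation by `w` turns `-ν|z|² + ν z̄ w` into `-ν|z|² - ν w̄ z`, so the integrand becomes a
Gaussian times an entire function whose value at `0` is `d w`. -/
theorem integral_reproducing {ν : ℝ} (hν : 0 < ν) {d : ℂ → ℂ} (hd : Differentiable ℂ d) (w : ℂ)
    (hi : Integrable fun z : ℂ => Real.exp (-ν * ‖z‖ ^ 2) •
      (Complex.exp (ν * (starRingEnd ℂ z * w)) * d z)) :
    ∫ z : ℂ, Real.exp (-ν * ‖z‖ ^ 2) • (Complex.exp (ν * (starRingEnd ℂ z * w)) * d z)
      = (Real.pi / ν) • d w := by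
  have e : ∀ z : ℂ, Real.exp (-ν * ‖z + w‖ ^ 2) •
      (Complex.exp (ν * (starRingEnd ℂ (z + w) * w)) * d (z + w))
      = Real.exp (-ν * ‖z‖ ^ 2) • (Complex.exp (-ν * (starRingEnd ℂ w * z)) * d (z + w)) := by
    intro z
    simp only [Complex.real_smul, Complex.ofReal_exp, ← mul_assoc, ← Complex.exp_add]
    congr 2
    push_cast
    rw [← Complex.mul_conj', ← Complex.mul_conj', map_add]
    ring
  have hH : Differentiable ℂ fun z => Complex.exp (-ν * (starRingEnd ℂ w * z)) * d (z + w) := by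
    fun_prop
  have h := integral_gaussian_smul_entire hν hH
    ((hi.comp_add_right w).congr (Filter.Eventually.of_forall e))
  rw [← integral_add_right_eq_self _ w]
  simp only [e]
  rw [h]
  simp

theorem integral_inner_gaussianWeighted_exp {ν : ℝ} (hν : 0 < ν) {D : ℂ → E}
    (hD : Differentiable ℂ D) (w : ℂ) (c : E)
    (hi : Integrable fun p => inner ℂ
      (gaussianWeighted ν (fun z => Complex.exp (ν * (z * starRingEnd ℂ w)) • c) p)
      (gaussianWeighted ν D p)) :
    ∫ p, inner ℂ
      (gaussianWeighted ν (fun z => Complex.exp (ν * (z * starRingEnd ℂ w)) • c) p)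
      (gaussianWeighted ν D p) = (Real.pi / ν) • inner ℂ c (D w) := by
  set f : ℂ → ℂ := fun z => Real.exp (-ν * ‖z‖ ^ 2) •
      (Complex.exp (ν * (starRingEnd ℂ z * w)) * inner ℂ c (D z)) with hf
  have e : (fun p => inner ℂ
      (gaussianWeighted ν (fun z => Complex.exp (ν * (z * starRingEnd ℂ w)) • c) p)
      (gaussianWeighted ν D p)) = f ∘ Complex.measurableEquivRealProd.symm := by
    funext p
    have hz : Complex.measurableEquivRealProd.symm p = p.1 + p.2 * Complex.I :=
      Complex.mk_eq_add_mul_I p.1 p.2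
    have hn : ‖(p.1 + p.2 * Complex.I : ℂ)‖ ^ 2 = p.1 ^ 2 + p.2 ^ 2 := by
      rw [Complex.sq_norm, Complex.normSq_add_mul_I]
    simp only [Function.comp_apply, hz, hf, gaussianWeighted, hn]
    rw [← Complex.coe_smul, ← Complex.coe_smul, inner_smul_left, inner_smul_left,
      inner_smul_right, Complex.conj_ofReal, ← Complex.exp_conj, Complex.real_smul]
    have hs : (Real.exp (-ν * (p.1 ^ 2 + p.2 ^ 2)) : ℂ)
        = Real.exp (-ν / 2 * (p.1 ^ 2 + p.2 ^ 2)) * Real.exp (-ν / 2 * (p.1 ^ 2 + p.2 ^ 2)) := by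
      rw [← Complex.ofReal_mul, ← Real.exp_add]
      congr 2
      ring
    rw [hs, map_mul, map_mul, Complex.conj_ofReal, Complex.conj_conj]
    ring
  have hmp := Complex.volume_preserving_equiv_real_prod.symm
  rw [e] at hi ⊢
  rw [hmp.integrable_comp_emb (MeasurableEquiv.measurableEmbedding _)] at hi
  rw [← integral_reproducing hν (d := fun z => inner ℂ c (D z)) _ w hi]
  · exact hmp.integral_comp (MeasurableEquiv.measurableEmbedding _) f
  · exact (innerSL ℂ c).differentiable.comp hD

end ReproducingKernel

/-! ### Surjectivity onto square integrable entire functions. -/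

section Surjectivity

variable {E : Type*} [NormedAddCommGroup E] [InnerProductSpace ℂ E]

theorem complexTransform_congr_ae (ν : ℝ) {φ ψ : ℝ → E} (h : φ =ᵐ[volume] ψ) :
    complexTransform ν φ = complexTransform ν ψ := by
  funext z
  refine integral_congr_ae ?_
  filter_upwards [h] with x hx
  rw [hx]

theorem complexTransform_add {ν : ℝ} (hν : 0 < ν) {φ ψ : ℝ → E} (hφ : MemLp φ 2)
    (hψ : MemLp ψ 2) :
    complexTransform ν (φ + ψ) = complexTransform ν φ + complexTransform ν ψ := by
  funext z
  simp only [complexTransform, Pi.add_apply, smul_add]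
  exact integral_add (integrable_complexKernel_smul hν hφ z) (integrable_complexKernel_smul hν hψ z)

theorem complexTransform_smul (ν : ℝ) (c : ℂ) (ψ : ℝ → E) :
    complexTransform ν (c • ψ) = c • complexTransform ν ψ := by
  funext z
  simp only [complexTransform, Pi.smul_apply, smul_comm _ c]
  exact integral_smul c _

theorem continuous_complexKernel (ν : ℝ) (z : ℂ) : Continuous (complexKernel ν z) := by
  unfold complexKernel
  fun_prop

theorem memLp_complexKernel {ν : ℝ} (hν : 0 < ν) (z : ℂ) : MemLp (complexKernel ν z) 2 := by
  refine ((memLp_exp_quadratic (half_pos hν) (ν * √2 * z.re)).const_mul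
    ((ν / Real.pi) ^ (3 / 4 : ℝ) * Real.exp (-(ν / 2) * (z ^ 2).re))).congr_norm
    (continuous_complexKernel ν z).aestronglyMeasurable (Filter.Eventually.of_forall fun x => ?_)
  rw [complexKernel, norm_mul _ (Complex.exp _), Complex.norm_real, Complex.norm_exp, norm_mul,
    norm_mul, Real.norm_of_nonneg (Real.exp_pos _).le, Real.norm_of_nonneg (Real.exp_pos _).le,
    mul_assoc, ← Real.exp_add]
  congr 2
  simp [pow_two]
  ring

variable [CompleteSpace E]

/-- The transform of the conjugate kernel is the reproducing kernel of the Fock space. -/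
theorem complexTransform_conj_complexKernel {ν : ℝ} (hν : 0 < ν) (w z : ℂ) (c : E) :
    complexTransform ν (fun x => starRingEnd ℂ (complexKernel ν w x) • c) z
      = (ν / Real.pi) • Complex.exp (ν * (z * starRingEnd ℂ w)) • c := by
  have hpi := Real.pi_pos
  have h0 : 0 < ν / Real.pi := by positivity
  have h2 : (√2 : ℂ) ^ 2 = 2 := by
    rw [← Complex.ofReal_pow, Real.sq_sqrt (by norm_num)]; norm_num
  have hνc : (ν : ℂ) ≠ 0 := by exact_mod_cast hν.ne'
  set w' := starRingEnd ℂ w with hw'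
  have e : ∀ x : ℝ, complexKernel ν z x * starRingEnd ℂ (complexKernel ν w x)
      = ((ν / Real.pi) ^ (3 / 2 : ℝ) : ℝ) * Complex.exp ((-ν : ℝ) * x ^ 2 +
        (ν * √2 * (z + w')) * x + (-ν / 2 * (z ^ 2 + w' ^ 2))) := fun x => by
    have hc : ((ν / Real.pi) ^ (3 / 2 : ℝ) : ℝ)
        = (ν / Real.pi) ^ (3 / 4 : ℝ) * (ν / Real.pi) ^ (3 / 4 : ℝ) := by
      rw [← Real.rpow_add h0]; norm_num
    rw [complexKernel, complexKernel, map_mul, Complex.conj_ofReal, ← Complex.exp_conj,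
      mul_mul_mul_comm, ← Complex.exp_add, hc, ← Complex.ofReal_mul]
    congr 2
    rw [map_add, map_mul, map_mul, map_mul, map_add, map_pow, map_pow, Complex.conj_ofReal,
      Complex.conj_ofReal, Complex.conj_ofReal, ← hw']
    push_cast
    ring
  have hI : ∫ x : ℝ, complexKernel ν z x * starRingEnd ℂ (complexKernel ν w x)
      = (ν / Real.pi : ℝ) * Complex.exp (ν * (z * w')) := by
    simp only [e]
    rw [integral_const_mul, integral_cexp_quadratic (by simpa using hν)]
    have e1 : ((Real.pi : ℂ) / -((-ν : ℝ) : ℂ)) ^ (1 / 2 : ℂ)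
        = (((Real.pi / ν) ^ (1 / 2 : ℝ) : ℝ) : ℂ) := by
      rw [Complex.ofReal_cpow (by positivity)]
      push_cast
      simp
    have e2 : (ν / Real.pi) ^ (3 / 2 : ℝ) * (Real.pi / ν) ^ (1 / 2 : ℝ) = ν / Real.pi := by
      rw [← inv_div ν Real.pi, Real.inv_rpow h0.le, ← Real.rpow_neg h0.le, ← Real.rpow_add h0]
      norm_num
    rw [e1, ← mul_assoc, ← Complex.ofReal_mul, e2]
    congr 2
    push_cast
    field_simp
    ring_nf
    simp only [h2]
    ring
  rw [complexTransform]
  simp only [smul_smul]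
  rw [integral_smul_const, hI, mul_smul, Complex.coe_smul]

theorem memLp_gaussianWeighted_complexTransform {ν : ℝ} (hν : 0 < ν) {ψ : ℝ → E}
    (hψ : MemLp ψ 2) : MemLp (gaussianWeighted ν (complexTransform ν ψ)) 2 := by
  refine ⟨(continuous_gaussianWeighted ν
    (differentiable_complexTransform hν hψ).continuous).aestronglyMeasurable, ?_⟩
  have h : eLpNorm (gaussianWeighted ν (complexTransform ν ψ)) 2 ^ 2 < ⊤ := by
    rw [eLpNorm_two_sq, lintegral_gaussianWeighted_complexTransform hν hψ, ← eLpNorm_two_sq]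
    exact ENNReal.pow_lt_top hψ.2
  simpa using h

theorem eLpNorm_gaussianWeighted_complexTransform {ν : ℝ} (hν : 0 < ν) {ψ : ℝ → E}
    (hψ : MemLp ψ 2) :
    eLpNorm (gaussianWeighted ν (complexTransform ν ψ)) 2 = eLpNorm ψ 2 := by
  refine (ENNReal.pow_right_strictMono two_ne_zero).injective ?_
  rw [eLpNorm_two_sq, eLpNorm_two_sq, lintegral_gaussianWeighted_complexTransform hν hψ]

/-- The Segal-Bargmann transform as a linear isometry into the space of square integrable functions
on the plane. -/
noncomputable def transformIsometry {ν : ℝ} (hν : 0 < ν) :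
    Lp E 2 (volume : Measure ℝ) →ₗᵢ[ℂ] Lp E 2 (volume : Measure (ℝ × ℝ)) where
  toFun ψ := (memLp_gaussianWeighted_complexTransform hν (Lp.memLp ψ)).toLp _
  map_add' φ ψ := by
    rw [← MemLp.toLp_add]
    congr 1
    rw [complexTransform_congr_ae ν (Lp.coeFn_add φ ψ),
      complexTransform_add hν (Lp.memLp φ) (Lp.memLp ψ)]
    funext p
    simp [gaussianWeighted]
  map_smul' c ψ := by
    rw [RingHom.id_apply, ← MemLp.toLp_const_smul]
    congr 1
    rw [complexTransform_congr_ae ν (Lp.coeFn_smul c ψ), complexTransform_smul]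
    funext p
    simp [gaussianWeighted, smul_comm c]
  norm_map' ψ := by
    rw [LinearMap.coe_mk, AddHom.coe_mk, Lp.norm_toLp,
      eLpNorm_gaussianWeighted_complexTransform hν (Lp.memLp ψ), Lp.norm_def]

theorem coeFn_transformIsometry {ν : ℝ} (hν : 0 < ν) (ψ : Lp E 2 (volume : Measure ℝ)) :
    (transformIsometry hν ψ : ℝ × ℝ → E) =ᵐ[volume]
      gaussianWeighted ν (complexTransform ν ψ) :=
  (memLp_gaussianWeighted_complexTransform hν (Lp.memLp ψ)).coeFn_toLp

/-- Every square integrable entire function is a Segal-Bargmann transform. -/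
theorem exists_complexTransform_eq {ν : ℝ} (hν : 0 < ν) {F : ℂ → E} (hF : Differentiable ℂ F)
    (hF2 : MemLp (gaussianWeighted ν F) 2) :
    ∃ ψ : ℝ → E, MemLp ψ 2 ∧ complexTransform ν ψ = F := by
  have hpi := Real.pi_pos
  let T : Lp E 2 (volume : Measure ℝ) →ₗᵢ[ℂ] Lp E 2 (volume : Measure (ℝ × ℝ)) :=
    transformIsometry hν
  let K : Submodule ℂ (Lp E 2 (volume : Measure (ℝ × ℝ))) := T.toLinearMap.range
  -- The isometric image of a complete space is complete, so the orthogonal projection onto it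
  -- exists.
  have : CompleteSpace K := T.isometry.isUniformInducing.isComplete_range.completeSpace_coe
  obtain ⟨_, ⟨ψ, rfl⟩, r, hr, hsum⟩ := K.exists_add_mem_mem_orthogonal (hF2.toLp _)
  refine ⟨ψ, Lp.memLp ψ, ?_⟩
  set D : ℂ → E := F - complexTransform ν ψ with hDdef
  have hD : Differentiable ℂ D := hF.sub (differentiable_complexTransform hν (Lp.memLp ψ))
  have hrD : (r : ℝ × ℝ → E) =ᵐ[volume] gaussianWeighted ν D := by
    have e : r = hF2.toLp _ - T ψ := by rw [hsum]; simp
    have h1 : (T ψ : ℝ × ℝ → E) =ᵐ[volume] gaussianWeighted ν (complexTransform ν ψ) :=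
      coeFn_transformIsometry hν ψ
    rw [e]
    filter_upwards [Lp.coeFn_sub (hF2.toLp _) (T ψ), hF2.coeFn_toLp, h1] with p h2 h3 h4
    rw [h2, Pi.sub_apply, h3, h4]
    simp [gaussianWeighted, hDdef, smul_sub]
  suffices h : ∀ w, D w = 0 by
    funext w
    exact (sub_eq_zero.mp (h w)).symm
  intro w
  refine ext_inner_left ℂ fun c => ?_
  rw [inner_zero_right]
  -- The preimage of the reproducing kernel at `w` in direction `c`, up to the factor `ν / π`.
  have hφ : MemLp (fun x => starRingEnd ℂ (complexKernel ν w x) • c) 2 :=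
    ((memLp_complexKernel hν w).norm.const_mul ‖c‖).congr_norm
      (((Complex.continuous_conj.comp (continuous_complexKernel ν w)).smul
        continuous_const).aestronglyMeasurable)
      (Filter.Eventually.of_forall fun x => by simp [norm_smul, mul_comm])
  have hperp : inner ℂ (T (hφ.toLp _)) r = 0 := hr _ ⟨_, rfl⟩
  have hTφ : (T (hφ.toLp _) : ℝ × ℝ → E) =ᵐ[volume] gaussianWeighted ν
      (fun z => Complex.exp (ν * (z * starRingEnd ℂ w)) • ((ν / Real.pi) • c)) := by
    have h1 : (T (hφ.toLp _) : ℝ × ℝ → E) =ᵐ[volume]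
      gaussianWeighted ν (complexTransform ν (hφ.toLp _)) :=
      coeFn_transformIsometry hν _
    refine h1.trans (Filter.EventuallyEq.of_eq ?_)
    rw [complexTransform_congr_ae ν hφ.coeFn_toLp]
    congr 1
    funext z
    rw [complexTransform_conj_complexKernel hν, smul_comm]
  have hae : (fun p => inner ℂ ((T (hφ.toLp _) : ℝ × ℝ → E) p) (r p)) =ᵐ[volume]
      fun p => inner ℂ (gaussianWeighted ν
        (fun z => Complex.exp (ν * (z * starRingEnd ℂ w)) • ((ν / Real.pi) • c)) p)
        (gaussianWeighted ν D p) := by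
    filter_upwards [hTφ, hrD] with p h1 h2
    rw [h1, h2]
  rw [L2.inner_def, integral_congr_ae hae, integral_inner_gaussianWeighted_exp hν hD w _
    ((L2.integrable_inner _ _).congr hae), ← Complex.coe_smul (ν / Real.pi) c,
    inner_smul_left] at hperp
  simpa [hpi.ne', hν.ne'] using hperp

end Surjectivity

/-! ### Slices and the complex structures they induce on `ℍ`. -/

section SliceStructure

/-- The imaginary components of `I²` are `2 re I` times those of `I`; if `re I ≠ 0` then `I` is
real, with square `-1`. -/
theorem re_eq_zero_of_sq_eq_neg_one {I : ℍ} (hI : I ^ 2 = -1) : I.re = 0 := by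
  have h0 := congrArg (fun q : ℍ => q.re) hI
  have h1 := congrArg (fun q : ℍ => q.imI) hI
  have h2 := congrArg (fun q : ℍ => q.imJ) hI
  have h3 := congrArg (fun q : ℍ => q.imK) hI
  simp [pow_two] at h0 h1 h2 h3
  by_contra h
  have e1 : I.imI = 0 := by
    have : I.re * I.imI = 0 := by linarith
    exact (mul_eq_zero.mp this).resolve_left h
  have e2 : I.imJ = 0 := by
    have : I.re * I.imJ = 0 := by linarith
    exact (mul_eq_zero.mp this).resolve_left h
  have e3 : I.imK = 0 := by
    have : I.re * I.imK = 0 := by linarith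
    exact (mul_eq_zero.mp this).resolve_left h
  rw [e1, e2, e3] at h0
  nlinarith [sq_nonneg I.re]

theorem norm_eq_one_of_sq_eq_neg_one {I : ℍ} (hI : I ^ 2 = -1) : ‖I‖ = 1 := by
  have h := congrArg norm hI
  rw [norm_pow, norm_neg, norm_one] at h
  exact (pow_eq_one_iff_of_nonneg (norm_nonneg _) two_ne_zero).mp h

theorem norm_sq_add_mul {I : ℍ} (hI : I ^ 2 = -1) (x y : ℝ) :
    ‖(x : ℍ) + (y : ℍ) * I‖ ^ 2 = x ^ 2 + y ^ 2 := by
  have h1 : ‖I‖ ^ 2 = 1 := by rw [norm_eq_one_of_sq_eq_neg_one hI, one_pow]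
  rw [pow_two, ← Quaternion.normSq_eq_norm_mul_self, Quaternion.normSq_def'] at h1 ⊢
  simp [re_eq_zero_of_sq_eq_neg_one hI] at h1 ⊢
  linear_combination y ^ 2 * h1

/-- The embedding `x + i y ↦ x + y I` of `ℂ` onto the slice `ℂ_I`. -/
noncomputable def sliceEmbedding {I : ℍ} (hI : I ^ 2 = -1) : ℂ →ₐ[ℝ] ℍ :=
  Complex.lift ⟨I, by rw [← pow_two, hI]⟩

theorem sliceEmbedding_apply {I : ℍ} (hI : I ^ 2 = -1) (z : ℂ) :
    sliceEmbedding hI z = (z.re : ℍ) + (z.im : ℍ) * I := by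
  rw [sliceEmbedding, Complex.lift_apply, Complex.liftAux_apply, ← Quaternion.coe_mul_eq_smul]
  rfl

theorem norm_sliceEmbedding {I : ℍ} (hI : I ^ 2 = -1) (z : ℂ) : ‖sliceEmbedding hI z‖ = ‖z‖ := by
  have h : ‖sliceEmbedding hI z‖ ^ 2 = ‖z‖ ^ 2 := by
    rw [sliceEmbedding_apply, norm_sq_add_mul hI, Complex.sq_norm, Complex.normSq_apply]
    ring
  exact (sq_eq_sq₀ (norm_nonneg _) (norm_nonneg _)).mp h

theorem continuous_sliceEmbedding {I : ℍ} (hI : I ^ 2 = -1) : Continuous (sliceEmbedding hI) :=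
  (sliceEmbedding hI).toLinearMap.continuous_of_finiteDimensional

/-- The quaternions as a complex vector space, `ℂ` acting by left multiplication through the
slice `ℂ_I`. -/
def SliceModule {I : ℍ} (_ : I ^ 2 = -1) : Type := ℍ

variable {I : ℍ} (hI : I ^ 2 = -1)

noncomputable instance : NormedAddCommGroup (SliceModule hI) :=
  inferInstanceAs (NormedAddCommGroup ℍ)

instance : CompleteSpace (SliceModule hI) :=
  inferInstanceAs (CompleteSpace ℍ)

/-- The action depends on `I`, so each slice needs its own copy of `ℍ`. -/
noncomputable instance : Module ℂ (SliceModule hI) :=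
  Module.compHom ℍ (sliceEmbedding hI).toRingHom

noncomputable instance : NormedSpace ℂ (SliceModule hI) where
  norm_smul_le z q := by
    have h : ∀ a : ℍ, ‖sliceEmbedding hI z * a‖ ≤ ‖z‖ * ‖a‖ := fun a => by
      rw [norm_mul, norm_sliceEmbedding]
    exact h q

/-- The parallelogram law suffices: no formula for this inner product is needed, as the quaternionic
one is recovered from norms. -/
noncomputable instance : InnerProductSpace ℂ (SliceModule hI) :=
  InnerProductSpace.ofNorm ℂ fun x y => by
    have h : ∀ a b : ℍ, ‖a + b‖ * ‖a + b‖ + ‖a - b‖ * ‖a - b‖ = 2 * (‖a‖ * ‖a‖ + ‖b‖ * ‖b‖) :=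
      fun a b => by simpa only [pow_two] using parallelogram_law_with_norm ℝ a b
    exact h x y

/-- The identity map from the quaternions to `SliceModule hI`. -/
noncomputable def toSlice : ℍ ≃ₗᵢ[ℝ] SliceModule hI where
  toFun q := q
  invFun q := q
  left_inv _ := rfl
  right_inv _ := rfl
  map_add' _ _ := rfl
  map_smul' r q := by
    have h : (r • q : ℍ) = sliceEmbedding hI (r : ℂ) * q := by
      rw [sliceEmbedding_apply]
      simp [Quaternion.coe_mul_eq_smul]
    exact h
  norm_map' _ := rfl

theorem toSlice_mul (z : ℂ) (q : ℍ) : toSlice hI (sliceEmbedding hI z * q) = z • toSlice hI q := rfl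

/-- The restriction of `f` to the slice `ℂ_I`, as a function of a complex variable. -/
noncomputable def sliceRestrict (f : ℍ → ℍ) (z : ℂ) : SliceModule hI :=
  toSlice hI (f (sliceEmbedding hI z))

theorem sliceRestrict_mk (f : ℍ → ℍ) (x y : ℝ) :
    sliceRestrict hI f (x + y * Complex.I) = toSlice hI (sliceFun f I (x, y)) := by
  simp [sliceRestrict, sliceFun, sliceEmbedding_apply]

end SliceStructure

/-! ### Slice regularity as holomorphy on slices. -/

section SliceRegularity

variable {I : ℍ} (hI : I ^ 2 = -1) {f g : ℍ → ℍ}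

theorem differentiable_real_sliceRestrict (hf : Differentiable ℝ f) :
    Differentiable ℝ (sliceRestrict hI f) :=
  (toSlice hI).toContinuousLinearEquiv.differentiable.comp
    (hf.comp (sliceEmbedding hI).toLinearMap.toContinuousLinearMap.differentiable)

theorem fderiv_sliceRestrict_one (hf : Differentiable ℝ f) (x y : ℝ) :
    fderiv ℝ (sliceRestrict hI f) (x + y * Complex.I) 1
      = toSlice hI (deriv (fun s : ℝ => sliceFun f I (s, y)) x) := by
  have h1 : HasDerivAt (fun s : ℝ => (s + y * Complex.I : ℂ)) 1 x :=
    (Complex.ofRealCLM.hasDerivAt (x := x)).add_const _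
  have h2 := (differentiable_real_sliceRestrict hI hf
    (x + y * Complex.I)).hasFDerivAt.comp_hasDerivAt x h1
  have h3 := (toSlice hI).symm.toContinuousLinearEquiv.hasFDerivAt.comp_hasDerivAt x h2
  have e : (fun s : ℝ => sliceFun f I (s, y))
      = fun s : ℝ => (toSlice hI).symm (sliceRestrict hI f (s + y * Complex.I)) := by
    funext s
    rw [sliceRestrict_mk]; rfl
  rw [e]
  exact (congrArg (toSlice hI) h3.deriv).symm

theorem fderiv_sliceRestrict_I (hf : Differentiable ℝ f) (x y : ℝ) :
    fderiv ℝ (sliceRestrict hI f) (x + y * Complex.I) Complex.I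
      = toSlice hI (deriv (fun t : ℝ => sliceFun f I (x, t)) y) := by
  have h1 : HasDerivAt (fun t : ℝ => (x + t * Complex.I : ℂ)) Complex.I y := by
    simpa using ((Complex.ofRealCLM.hasDerivAt (x := y)).mul_const Complex.I).const_add (x : ℂ)
  have h2 := (differentiable_real_sliceRestrict hI hf
    (x + y * Complex.I)).hasFDerivAt.comp_hasDerivAt y h1
  have h3 := (toSlice hI).symm.toContinuousLinearEquiv.hasFDerivAt.comp_hasDerivAt y h2
  have e : (fun t : ℝ => sliceFun f I (x, t))
      = fun t : ℝ => (toSlice hI).symm (sliceRestrict hI f (x + t * Complex.I)) := by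
    funext s
    rw [sliceRestrict_mk]; rfl
  rw [e]
  exact (congrArg (toSlice hI) h3.deriv).symm

theorem sliceEmbedding_I : sliceEmbedding hI Complex.I = I := by
  simp [sliceEmbedding_apply]

theorem toSlice_dbar (hf : Differentiable ℝ f) (x y : ℝ) :
    toSlice hI (dbar I f x y) = (1 / 2 : ℝ) •
      (fderiv ℝ (sliceRestrict hI f) (x + y * Complex.I) 1
        + Complex.I • fderiv ℝ (sliceRestrict hI f) (x + y * Complex.I) Complex.I) := by
  rw [dbar, map_smul, map_add, fderiv_sliceRestrict_one hI hf, fderiv_sliceRestrict_I hI hf,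
    ← toSlice_mul, sliceEmbedding_I]

/-- These are the Cauchy-Riemann equations: `a + i b = 0` is `b = i a` after multiplication by `i`.
-/
theorem dbar_eq_zero_iff (hf : Differentiable ℝ f) (x y : ℝ) :
    dbar I f x y = 0 ↔ DifferentiableAt ℂ (sliceRestrict hI f) (x + y * Complex.I) := by
  rw [differentiableAt_complex_iff_differentiableAt_real,
    ← (toSlice hI).toLinearEquiv.map_eq_zero_iff]
  change toSlice hI _ = 0 ↔ _
  rw [toSlice_dbar hI hf]
  simp only [(differentiable_real_sliceRestrict hI hf) _, true_and]
  set a := fderiv ℝ (sliceRestrict hI f) (x + y * Complex.I) 1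
  set b := fderiv ℝ (sliceRestrict hI f) (x + y * Complex.I) Complex.I
  constructor
  · intro h
    have h' : a + Complex.I • b = 0 := (smul_eq_zero.mp h).resolve_left (by norm_num)
    have := congrArg (fun v => Complex.I • v) h'
    simp only [smul_add, smul_smul, Complex.I_mul_I, neg_smul, one_smul, smul_zero] at this
    exact (sub_eq_zero.mp (by rw [sub_eq_add_neg]; exact this)).symm
  · intro h
    rw [h, smul_smul, Complex.I_mul_I, neg_smul, one_smul, add_neg_cancel, smul_zero]

theorem SliceRegular.differentiable_sliceRestrict (hf : SliceRegular f) :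
    Differentiable ℂ (sliceRestrict hI f) := fun z => by
  rw [← Complex.re_add_im z]
  exact (dbar_eq_zero_iff hI hf.differentiable _ _).mp (hf.dbar_eq_zero I hI _ _)

theorem sliceRegular_of_differentiable_sliceRestrict (hf : Differentiable ℝ f)
    (h : ∀ (K : ℍ) (hK : K ^ 2 = -1), Differentiable ℂ (sliceRestrict hK f)) :
    SliceRegular f where
  differentiable := hf
  contDiff_slice K hK := by
    have h1 : ContDiff ℝ 1 (sliceRestrict hK f) := (h K hK).contDiff.restrict_scalars ℝ
    have h2 : ContDiff ℝ 1 fun p : ℝ × ℝ => (p.1 + p.2 * Complex.I : ℂ) :=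
      (Complex.ofRealCLM.contDiff.comp contDiff_fst).add
        ((Complex.ofRealCLM.contDiff.comp contDiff_snd).mul contDiff_const)
    have h3 := (toSlice hK).symm.toContinuousLinearEquiv.contDiff.comp (h1.comp h2)
    have e : sliceFun f K = fun p : ℝ × ℝ =>
        (toSlice hK).symm (sliceRestrict hK f (p.1 + p.2 * Complex.I)) :=
      funext fun p => congrArg (toSlice hK).symm (sliceRestrict_mk hK f p.1 p.2).symm
    rw [e]
    exact h3
  dbar_eq_zero K hK x y := (dbar_eq_zero_iff hK hf x y).mpr (h K hK _)

theorem exists_slice (q : ℍ) (hI : I ^ 2 = -1) :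
    ∃ (K : ℍ) (hK : K ^ 2 = -1) (z : ℂ), sliceEmbedding hK z = q := by
  by_cases h : q.im = 0
  -- A real `q` determines no imaginary unit but lies in every slice, so the given `I` serves.
  · refine ⟨I, hI, q.re, ?_⟩
    rw [sliceEmbedding_apply]
    simp only [Complex.ofReal_re, Complex.ofReal_im, Quaternion.coe_zero, zero_mul, add_zero]
    nth_rewrite 2 [← Quaternion.re_add_im q]
    rw [h, add_zero]
  · have hn : ‖q.im‖ ≠ 0 := norm_ne_zero_iff.mpr h
    refine ⟨‖q.im‖⁻¹ • q.im, ?_, ⟨q.re, ‖q.im‖⟩, ?_⟩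
    · rw [smul_pow, Quaternion.im_sq, Quaternion.normSq_eq_norm_mul_self, smul_neg,
        Quaternion.smul_coe]
      rw [← pow_two, ← mul_pow, inv_mul_cancel₀ hn, one_pow, Quaternion.coe_one]
    · rw [sliceEmbedding_apply, Quaternion.coe_mul_eq_smul, smul_smul, mul_inv_cancel₀ hn,
        one_smul, Quaternion.re_add_im]

/-- Identity principle: slice regular functions agreeing on one slice are equal. -/
theorem SliceRegular.eq_of_eq_on_slice (hf : SliceRegular f) (hg : SliceRegular g)
    (h : ∀ z, f (sliceEmbedding hI z) = g (sliceEmbedding hI z)) : f = g := by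
  funext q
  obtain ⟨K, hK, z, rfl⟩ := exists_slice q hI
  -- All slices contain the real axis, where agreement accumulates at `0`; the identity theorem on
  -- `ℂ_K` finishes.
  have hreal : ∀ x : ℝ, sliceRestrict hK f x = sliceRestrict hK g x := fun x => by
    have e : sliceEmbedding hK (x : ℂ) = sliceEmbedding hI (x : ℂ) := by
      simp
    rw [sliceRestrict, sliceRestrict, e, h]
  have hfreq : ∃ᶠ w in nhdsWithin (0 : ℂ) {0}ᶜ, sliceRestrict hK f w = sliceRestrict hK g w := by
    have ht : Filter.Tendsto (fun x : ℝ => (x : ℂ)) (nhdsWithin 0 {0}ᶜ) (nhdsWithin 0 {0}ᶜ) :=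
      tendsto_nhdsWithin_iff.mpr ⟨(Complex.continuous_ofReal.tendsto' 0 0 rfl).mono_left
        nhdsWithin_le_nhds, by
          filter_upwards [self_mem_nhdsWithin] with x hx
          simpa using hx⟩
    exact ht.frequently (Filter.Eventually.of_forall hreal).frequently
  have heq := AnalyticOnNhd.eq_of_frequently_eq
    (fun w _ => (hf.differentiable_sliceRestrict hK).analyticAt w)
    (fun w _ => (hg.differentiable_sliceRestrict hK).analyticAt w) hfreq
  exact (toSlice hK).injective (congrFun heq z)

end SliceRegularity

/-! ### The quaternionic transform and its restriction to slices. -/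

section QuaternionicTransform

variable {ν : ℝ} {I : ℍ} (hI : I ^ 2 = -1) {φ ψ : ℝ → ℍ}

/-- Real quaternions are central, so the exponential splits and its Gaussian factor can be moved
onto `v`. -/
theorem kernel_mul_eq (ν : ℝ) (q : ℍ) (x : ℝ) (v : ℍ) :
    kernel ν q x * v = ((ν / Real.pi) ^ (3 / 4 : ℝ) : ℝ) •
      ContinuousLinearMap.mul ℝ ℍ (NormedSpace.exp
        ((-ν / 2 : ℝ) • q ^ 2 + ((ν * √2 : ℝ) * x) • q))
        (Real.exp (-(ν / 2) * x ^ 2) • v) := by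
  have e : (-ν / 2 : ℝ) • (q ^ 2 + (x : ℍ) ^ 2) + (ν * √2 : ℝ) • (q * (x : ℍ))
      = ((-ν / 2 : ℝ) • q ^ 2 + ((ν * √2 : ℝ) * x) • q) + ((-(ν / 2) * x ^ 2 : ℝ) : ℍ) := by
    rw [Quaternion.mul_coe_eq_smul, smul_add, smul_smul, ← Quaternion.coe_pow, Quaternion.smul_coe,
      neg_div]
    abel
  let _ : NormedAlgebra ℚ ℍ := .restrictScalars ℚ ℝ ℍ
  rw [kernel, e, NormedSpace.exp_add_of_commute (Quaternion.coe_commute _ _).symm,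
    Quaternion.exp_coe, ← Real.exp_eq_exp_ℝ, ContinuousLinearMap.mul_apply', smul_mul_assoc,
    mul_assoc, Quaternion.coe_mul_eq_smul]

theorem aestronglyMeasurable_gaussian_smul (ν : ℝ) (hψ : MemLp ψ 2) :
    AEStronglyMeasurable fun x : ℝ => Real.exp (-(ν / 2) * x ^ 2) • ψ x :=
  (by fun_prop : Continuous fun x : ℝ => Real.exp (-(ν / 2) * x ^ 2)
    ).aestronglyMeasurable.smul hψ.1

theorem integrable_kernel_mul (hν : 0 < ν) (hψ : MemLp ψ 2) (q : ℍ) :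
    Integrable fun x => kernel ν q x * ψ x := by
  simp only [kernel_mul_eq]
  exact Integrable.smul ((ν / Real.pi) ^ (3 / 4 : ℝ)) (integrable_exp_apply (𝕜 := ℝ) _ _ _
    (aestronglyMeasurable_gaussian_smul ν hψ)
    (integrable_exp_abs_mul_norm_gaussian_smul (half_pos hν) hψ) q)

/-- Differentiability transverse to a slice is invisible on that slice, so the integral is
differentiated over `ℍ` as a real Banach algebra. -/
theorem differentiable_transform (hν : 0 < ν) (hψ : MemLp ψ 2) :
    Differentiable ℝ (transform ν ψ) := by
  have h := differentiable_integral_exp (𝕜 := ℝ) (ContinuousLinearMap.mul ℝ ℍ)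
    (-ν / 2 : ℝ) (ν * √2 : ℝ) (aestronglyMeasurable_gaussian_smul ν hψ)
    (integrable_exp_abs_mul_norm_gaussian_smul (half_pos hν) hψ)
  have e : transform ν ψ = fun q => ((ν / Real.pi) ^ (3 / 4 : ℝ) : ℝ) • ∫ x : ℝ,
      ContinuousLinearMap.mul ℝ ℍ (NormedSpace.exp
        ((-ν / 2 : ℝ) • q ^ 2 + ((ν * √2 : ℝ) * x) • q))
        (Real.exp (-(ν / 2) * x ^ 2) • ψ x) := by
    funext q
    simp only [transform, kernel_mul_eq]
    rw [integral_smul]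
  rw [e]
  exact h.const_smul ((ν / Real.pi) ^ (3 / 4 : ℝ))

/-- A continuous algebra homomorphism commutes with `exp`. -/
theorem kernel_sliceEmbedding (ν : ℝ) (z : ℂ) (x : ℝ) :
    kernel ν (sliceEmbedding hI z) x = sliceEmbedding hI (complexKernel ν z x) := by
  have hx : (x : ℍ) = sliceEmbedding hI (x : ℂ) := by simp
  rw [kernel, complexKernel, ← Complex.real_smul, map_smul, Complex.exp_eq_exp_ℂ,
    NormedSpace.map_exp (sliceEmbedding hI) (continuous_sliceEmbedding hI), map_add,
    ← Complex.real_smul, ← Complex.real_smul, map_smul, map_smul, map_add, map_pow, map_pow,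
    map_mul, ← hx]

theorem memLp_toSlice (hψ : MemLp ψ 2) : MemLp (fun x => toSlice hI (ψ x)) 2 :=
  hψ.congr_norm ((toSlice hI).continuous.comp_aestronglyMeasurable hψ.1)
    (Filter.Eventually.of_forall fun _ => ((toSlice hI).norm_map _).symm)

theorem sliceRestrict_transform (ν : ℝ) (ψ : ℝ → ℍ) :
    sliceRestrict hI (transform ν ψ) = complexTransform ν (fun x => toSlice hI (ψ x)) := by
  funext z
  rw [sliceRestrict, transform, complexTransform]
  refine ((toSlice hI).toContinuousLinearEquiv.integral_comp_comm _).symm.trans ?_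
  refine integral_congr_ae (Filter.Eventually.of_forall fun x => ?_)
  simp only [kernel_sliceEmbedding]
  exact toSlice_mul hI _ _

theorem sliceRegular_transform (hν : 0 < ν) (hψ : MemLp ψ 2) : SliceRegular (transform ν ψ) :=
  sliceRegular_of_differentiable_sliceRestrict (differentiable_transform hν hψ) fun K hK => by
    rw [sliceRestrict_transform]
    exact differentiable_complexTransform hν (memLp_toSlice hK hψ)

theorem transform_congr_ae (ν : ℝ) (h : φ =ᵐ[volume] ψ) : transform ν φ = transform ν ψ := by
  funext q
  refine integral_congr_ae ?_
  filter_upwards [h] with x hx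
  rw [hx]

theorem transform_add (hν : 0 < ν) (hφ : MemLp φ 2) (hψ : MemLp ψ 2) :
    transform ν (φ + ψ) = transform ν φ + transform ν ψ := by
  funext q
  simp only [transform, Pi.add_apply, mul_add]
  exact integral_add (integrable_kernel_mul hν hφ q) (integrable_kernel_mul hν hψ q)

theorem transform_mul_const (hν : 0 < ν) (hψ : MemLp ψ 2) (c : ℍ) :
    transform ν (fun x => ψ x * c) = fun q => transform ν ψ q * c := by
  funext q
  simp only [transform, ← mul_assoc]
  exact integral_mul_const_of_integrable (integrable_kernel_mul hν hψ q)

end QuaternionicTransform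

/-! ### Fock norms as `L²` norms on the plane. -/

section FockNorm

variable {ν : ℝ} {I : ℍ} {f : ℍ → ℍ} {ψ : ℝ → ℍ}

/-- The restriction of `f` to the slice `ℂ_I` times the square root of the Gaussian weight. -/
noncomputable def weightedSlice (ν : ℝ) (I : ℍ) (f : ℍ → ℍ) (p : ℝ × ℝ) : ℍ :=
  Real.exp (-ν / 2 * (p.1 ^ 2 + p.2 ^ 2)) • sliceFun f I p

theorem toSlice_weightedSlice (hI : I ^ 2 = -1) (ν : ℝ) (f : ℍ → ℍ) (p : ℝ × ℝ) :
    toSlice hI (weightedSlice ν I f p) = gaussianWeighted ν (sliceRestrict hI f) p := by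
  rw [weightedSlice, gaussianWeighted, map_smul, sliceRestrict_mk]

theorem weight_eq (hI : I ^ 2 = -1) (ν : ℝ) (p : ℝ × ℝ) :
    weight ν I p = Real.exp (-ν / 2 * (p.1 ^ 2 + p.2 ^ 2)) ^ 2 := by
  rw [weight, norm_sq_add_mul hI, ← Real.exp_nat_mul]
  congr 1
  push_cast
  ring

theorem norm_weightedSlice_sq (hI : I ^ 2 = -1) (ν : ℝ) (f : ℍ → ℍ) (p : ℝ × ℝ) :
    ‖weightedSlice ν I f p‖ ^ 2 = ‖sliceFun f I p‖ ^ 2 * weight ν I p := by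
  rw [weightedSlice, norm_smul, mul_pow, weight_eq hI, Real.norm_of_nonneg (Real.exp_pos _).le,
    mul_comm]

theorem fockInner_eq (hI : I ^ 2 = -1) (ν : ℝ) (f g : ℍ → ℍ) :
    fockInner ν I f g = ∫ p, star (weightedSlice ν I g p) * weightedSlice ν I f p := by
  refine integral_congr_ae (Filter.Eventually.of_forall fun p => ?_)
  simp only [weightedSlice, weight_eq hI, Quaternion.star_smul, smul_mul_smul_comm, pow_two]

theorem continuous_weightedSlice (ν : ℝ) (I : ℍ) (hf : SliceRegular f) :
    Continuous (weightedSlice ν I f) := by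
  have := hf.continuous_slice I
  unfold weightedSlice
  fun_prop

theorem memLp_weightedSlice_iff (hI : I ^ 2 = -1) (ν : ℝ) (hf : SliceRegular f) :
    MemLp (weightedSlice ν I f) 2 ↔
      Integrable fun p : ℝ × ℝ => ‖sliceFun f I p‖ ^ 2 * weight ν I p := by
  rw [memLp_two_iff_integrable_sq_norm (continuous_weightedSlice ν I hf).aestronglyMeasurable]
  simp only [norm_weightedSlice_sq hI]

theorem eLpNorm_weightedSlice_transform (hI : I ^ 2 = -1) (hν : 0 < ν) (hψ : MemLp ψ 2) :
    eLpNorm (weightedSlice ν I (transform ν ψ)) 2 = eLpNorm ψ 2 := by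
  have h := eLpNorm_gaussianWeighted_complexTransform hν (memLp_toSlice hI hψ)
  rw [← sliceRestrict_transform, ← eLpNorm_congr_norm_ae (f := weightedSlice ν I (transform ν ψ)),
    ← eLpNorm_congr_norm_ae (f := ψ)] at h
  · exact h
  · exact Filter.Eventually.of_forall fun _ => ((toSlice hI).norm_map _).symm
  · refine Filter.Eventually.of_forall fun p => ?_
    rw [← toSlice_weightedSlice, LinearIsometryEquiv.norm_map]

theorem memLp_weightedSlice_transform (hI : I ^ 2 = -1) (hν : 0 < ν) (hψ : MemLp ψ 2) :
    MemLp (weightedSlice ν I (transform ν ψ)) 2 :=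
  ⟨(continuous_weightedSlice ν I (sliceRegular_transform hν hψ)).aestronglyMeasurable, by
    rw [eLpNorm_weightedSlice_transform hI hν hψ]; exact hψ.2⟩

theorem integral_norm_sq_eq {α : Type*} [MeasurableSpace α] {μ : Measure α} {u : α → ℍ}
    (hu : MemLp u 2 μ) : ∫ x, ‖u x‖ ^ 2 ∂μ = (eLpNorm u 2 μ).toReal ^ 2 := by
  rw [← ENNReal.toReal_pow, eLpNorm_two_sq,
    integral_eq_lintegral_of_nonneg_ae (Filter.Eventually.of_forall fun x => sq_nonneg _)
      (hu.1.norm.pow 2)]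
  congr 1
  refine lintegral_congr fun x => ?_
  rw [ENNReal.ofReal_pow (norm_nonneg _), ofReal_norm]

theorem integral_norm_sq_weightedSlice_transform (hI : I ^ 2 = -1) (hν : 0 < ν) (hψ : MemLp ψ 2) :
    ∫ p, ‖weightedSlice ν I (transform ν ψ) p‖ ^ 2 = ∫ x, ‖ψ x‖ ^ 2 := by
  rw [integral_norm_sq_eq (memLp_weightedSlice_transform hI hν hψ), integral_norm_sq_eq hψ,
    eLpNorm_weightedSlice_transform hI hν hψ]

theorem fockNorm_transform (hI : I ^ 2 = -1) (hν : 0 < ν) (hψ : MemLp ψ 2) :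
    fockNorm ν I (transform ν ψ) = (eLpNorm ψ 2).toReal := by
  rw [fockNorm]
  simp only [← norm_weightedSlice_sq hI]
  rw [integral_norm_sq_eq (memLp_weightedSlice_transform hI hν hψ),
    eLpNorm_weightedSlice_transform hI hν hψ, Real.sqrt_sq ENNReal.toReal_nonneg]

end FockNorm

/-! ### Quaternionic polarization. -/

section Polarization

theorem re_star_mul_star_mul (a b c : ℍ) :
    4 * (star c * (star b * a)).re = ‖a + b * c‖ ^ 2 - ‖a - b * c‖ ^ 2 := by
  have h : inner ℝ a (b * c) = (star c * (star b * a)).re := by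
    rw [real_inner_comm, Quaternion.inner_def, ← mul_assoc, ← star_mul]
    simp
    ring
  rw [← h, norm_add_sq_real, norm_sub_sq_real]
  ring

theorem memLp_mul_const {α : Type*} [MeasurableSpace α] {μ : Measure α} {u : α → ℍ}
    (hu : MemLp u 2 μ) (c : ℍ) : MemLp (fun x => u x * c) 2 μ :=
  (hu.norm.const_mul ‖c‖).congr_norm
    ((continuous_id.mul continuous_const).comp_aestronglyMeasurable hu.1)
    (Filter.Eventually.of_forall fun x => by simp [mul_comm])

/-- Letting `c` range over `ℍ` recovers every component of the pairing from norms alone, so a right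
linear isometry preserves it. -/
theorem re_star_mul_integral {α : Type*} [MeasurableSpace α] {μ : Measure α} {u v : α → ℍ}
    (hu : MemLp u 2 μ) (hv : MemLp v 2 μ) (c : ℍ) :
    4 * (star c * ∫ x, star (v x) * u x ∂μ).re
      = ∫ x, ‖u x + v x * c‖ ^ 2 ∂μ - ∫ x, ‖u x + v x * -c‖ ^ 2 ∂μ := by
  have hint : Integrable (fun x => star (v x) * u x) μ :=
    memLp_one_iff_integrable.mp (MemLp.mul (p := 2) (q := 2) hu
      (hv.congr_norm (continuous_star.comp_aestronglyMeasurable hv.1)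
        (Filter.Eventually.of_forall fun x => (norm_star _).symm)))
  have h1 : Integrable (fun x => ‖u x + v x * c‖ ^ 2) μ :=
    (hu.add (memLp_mul_const hv c)).integrable_norm_pow two_ne_zero
  have h2 : Integrable (fun x => ‖u x + v x * -c‖ ^ 2) μ :=
    (hu.add (memLp_mul_const hv (-c))).integrable_norm_pow two_ne_zero
  let ℓ : ℍ →L[ℝ] ℝ := (4 : ℝ) •
    ((innerSL ℝ (1 : ℍ)).comp (ContinuousLinearMap.mul ℝ ℍ (star c)))
  have hℓ : ∀ q, ℓ q = 4 * (star c * q).re := fun q => by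
    simp [ℓ, Quaternion.inner_def]
    ring
  rw [← hℓ, ← ContinuousLinearMap.integral_comp_comm _ hint, ← integral_sub h1 h2]
  refine integral_congr_ae (Filter.Eventually.of_forall fun x => ?_)
  simp only [hℓ]
  rw [re_star_mul_star_mul, mul_neg, sub_eq_add_neg (u x)]

theorem eq_of_forall_re_star_mul {a b : ℍ} (h : ∀ c, (star c * a).re = (star c * b).re) :
    a = b := by
  have h' := h (a - b)
  rw [← sub_eq_zero, ← Quaternion.re_sub, ← mul_sub, Quaternion.star_mul_self,
    Quaternion.re_coe, Quaternion.normSq_eq_zero] at h'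
  exact sub_eq_zero.mp h'

end Polarization

/-! ### Inner products and bijectivity. -/

section Unitarity

variable {ν : ℝ} {I : ℍ} {φ ψ : ℝ → ℍ}

theorem fockInner_transform (hν : 0 < ν) (hI : I ^ 2 = -1) (hφ : MemLp φ 2) (hψ : MemLp ψ 2) :
    fockInner ν I (transform ν φ) (transform ν ψ) = ∫ x, star (ψ x) * φ x := by
  rw [fockInner_eq hI]
  refine eq_of_forall_re_star_mul fun c => ?_
  have h4 : (4 : ℝ) ≠ 0 := by norm_num
  refine mul_left_cancel₀ h4 ?_
  -- By right linearity the left integrand comes from the transform of `φ + ψ c`.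
  have key : ∀ c : ℍ, ∫ p, ‖weightedSlice ν I (transform ν φ) p +
      weightedSlice ν I (transform ν ψ) p * c‖ ^ 2 = ∫ x, ‖φ x + ψ x * c‖ ^ 2 := fun c => by
    have h := integral_norm_sq_weightedSlice_transform hI hν (hφ.add (memLp_mul_const hψ c))
    rw [transform_add hν hφ (memLp_mul_const hψ c), transform_mul_const hν hψ] at h
    refine Eq.trans ?_ h
    refine integral_congr_ae (Filter.Eventually.of_forall fun p => ?_)
    simp [weightedSlice, sliceFun, smul_add]
  rw [re_star_mul_integral (memLp_weightedSlice_transform hI hν hφ)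
    (memLp_weightedSlice_transform hI hν hψ), re_star_mul_integral hφ hψ, key, key]

theorem transform_mem_fockSpace (hν : 0 < ν) (hI : I ^ 2 = -1) (hψ : MemLp ψ 2) :
    transform ν ψ ∈ fockSpace ν I :=
  ⟨sliceRegular_transform hν hψ, (memLp_weightedSlice_iff hI ν (sliceRegular_transform hν hψ)).mp
    (memLp_weightedSlice_transform hI hν hψ)⟩

theorem exists_transform_eq (hν : 0 < ν) (hI : I ^ 2 = -1) {f : ℍ → ℍ} (hf : f ∈ fockSpace ν I) :
    ∃ ψ : ℝ → ℍ, MemLp ψ 2 ∧ transform ν ψ = f := by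
  obtain ⟨hreg, hint⟩ := hf
  have hmem := (memLp_weightedSlice_iff hI ν hreg).mpr hint
  have hmem' : MemLp (gaussianWeighted ν (sliceRestrict hI f)) 2 := by
    have e : gaussianWeighted ν (sliceRestrict hI f)
        = fun p => toSlice hI (weightedSlice ν I f p) :=
      funext fun p => (toSlice_weightedSlice hI ν f p).symm
    rw [e]
    exact hmem.congr_norm ((toSlice hI).continuous.comp_aestronglyMeasurable hmem.1)
      (Filter.Eventually.of_forall fun _ => ((toSlice hI).norm_map _).symm)
  obtain ⟨χ, hχ, hχf⟩ :=
    exists_complexTransform_eq hν (hreg.differentiable_sliceRestrict hI) hmem'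
  have hψ : MemLp (fun x => (toSlice hI).symm (χ x)) 2 :=
    hχ.congr_norm ((toSlice hI).symm.continuous.comp_aestronglyMeasurable hχ.1)
      (Filter.Eventually.of_forall fun _ => ((toSlice hI).symm.norm_map _).symm)
  -- The complex theorem gives equality on `ℂ_I` only; the identity principle extends it to `ℍ`.
  refine ⟨_, hψ, (sliceRegular_transform hν hψ).eq_of_eq_on_slice hI hreg fun z => ?_⟩
  refine (toSlice hI).injective ?_
  have h := sliceRestrict_transform hI ν fun x => (toSlice hI).symm (χ x)
  simp only [LinearIsometryEquiv.apply_symm_apply] at h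
  exact congrFun (h.trans hχf) z

/-- The quaternionic Segal-Bargmann transform as a right `ℍ`-linear map into the Fock space. -/
noncomputable def transformLinearMap (hν : 0 < ν) (hI : I ^ 2 = -1) :
    Lp ℍ 2 (volume : Measure ℝ) →ₗ[ℍᵐᵒᵖ] fockSpace ν I where
  toFun ψ := ⟨transform ν ψ, transform_mem_fockSpace hν hI (Lp.memLp ψ)⟩
  map_add' φ ψ := by
    refine Subtype.ext ?_
    change transform ν _ = transform ν _ + transform ν _
    rw [transform_congr_ae ν (Lp.coeFn_add φ ψ), transform_add hν (Lp.memLp φ) (Lp.memLp ψ)]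
  map_smul' c ψ := by
    refine Subtype.ext ?_
    change transform ν _ = fun q => transform ν ψ q * c.unop
    rw [transform_congr_ae ν (Lp.coeFn_smul c ψ), ← transform_mul_const hν (Lp.memLp ψ)]
    rfl

theorem transformLinearMap_bijective (hν : 0 < ν) (hI : I ^ 2 = -1) :
    Function.Bijective (transformLinearMap hν hI) := by
  constructor
  · rw [injective_iff_map_eq_zero]
    intro ψ hψ
    have h0 : transform ν ψ = 0 := congrArg Subtype.val hψ
    have h := fockNorm_transform hI hν (Lp.memLp ψ)
    rw [h0, ← Lp.norm_def] at h
    rw [← norm_eq_zero, ← h]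
    simp [fockNorm, sliceFun]
  · rintro ⟨f, hf⟩
    obtain ⟨ψ, hψ, rfl⟩ := exists_transform_eq hν hI hf
    exact ⟨hψ.toLp ψ, Subtype.ext (transform_congr_ae ν hψ.coeFn_toLp)⟩

end Unitarity

end QuaternionicSegalBargmann

/-- For every slice `ℂ_I`, the integral defining `B_ν ψ (q)` converges for all `ψ ∈ L²(ℝ; ℍ)` and
`q ∈ ℍ`, and `B_ν` is a right `ℍ`-linear bijection of `L²(ℝ; ℍ)` onto the slice hyperholomorphic
Bargmann-Fock space which preserves the norm and the `ℍ`-valued inner product. -/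
theorem mainTheorem1 (ν : ℝ) (hν : 0 < ν) (I : ℍ) (hI : I ^ 2 = -1) :
    (∀ (ψ : Lp ℍ 2 (volume : Measure ℝ)) (q : ℍ),
      Integrable (fun x : ℝ => QuaternionicSegalBargmann.kernel ν q x * ψ x)) ∧
    ∃ U : Lp ℍ 2 (volume : Measure ℝ) ≃ₗ[ℍᵐᵒᵖ] QuaternionicSegalBargmann.fockSpace ν I,
      (∀ ψ : Lp ℍ 2 (volume : Measure ℝ),
        (U ψ : ℍ → ℍ) = QuaternionicSegalBargmann.transform ν ψ) ∧
      (∀ ψ : Lp ℍ 2 (volume : Measure ℝ),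
        QuaternionicSegalBargmann.fockNorm ν I (U ψ) = ‖ψ‖) ∧
      (∀ φ ψ : Lp ℍ 2 (volume : Measure ℝ),
        QuaternionicSegalBargmann.fockInner ν I (U φ) (U ψ) = ∫ x : ℝ, star (ψ x) * φ x) := by
  refine ⟨fun ψ q => QuaternionicSegalBargmann.integrable_kernel_mul hν (Lp.memLp ψ) q,
    LinearEquiv.ofBijective _ (QuaternionicSegalBargmann.transformLinearMap_bijective hν hI),
    fun ψ => rfl, fun ψ => ?_, fun φ ψ => ?_⟩
  · exact (QuaternionicSegalBargmann.fockNorm_transform hI hν (Lp.memLp ψ)).trans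
      (Lp.norm_def ψ).symm
  · exact QuaternionicSegalBargmann.fockInner_transform hν hI (Lp.memLp φ) (Lp.memLp ψ)
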